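/- Let $d\ge 1$, let $\mathcal P$ be the set of non-empty convex polytopes in $\mathbb R^d$ with the Hausdorff metric, let $\mathcal B$ be the Borel $\sigma$-algebra of $\mathbb R^d$ and let $\lambda$ be Lebesgue measure. A functional $\varphi:\mathcal P\to\mathbb R$ is called local if it has a local extension, i.e. a map $\Phi:\mathcal P\times\mathcal B\to\mathbb R$ such that $\Phi(\cdot,A)$ is Borel measurable for each $A\in\mathcal B$, $\Phi(P,\cdot)$ is a finite signed measure for each $P\in\mathcal P$, and - $\varphi(P)=\Phi(P,\mathbb R^d)$ for all $P$; - $\Phi(P+x,A+x)=\Phi(P,A)$ for all $P\in\mathcal P$, $A\in\mathcal B$, $x\in\mathbb R^d$; - $\Phi(P,A)=\Phi(Q,A)$ whenever there is an open set $U\supset A$ with $P\cap U=Q\cap U$. A functional $\varphi$ is $k$-homogeneous if $\varphi(\alpha P)=\alpha^k\varphi(P)$, and a map $\Phi$ assigning to each $P\in\mathcal P$ a finite signed Borel measure $\Phi(P,\cdot)$ (a measure-valued functional) is $k$-homogeneous if $\Phi(\alpha P,\alpha A)=\alpha^k\Phi(P,A)$, for all $\alpha>0$, $P\in\mathcal P$,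 $A\in\mathcal B$. Let $\mathcal F_j(P)$ be the set of $j$-dimensional faces of $P$ ($P$ being a face of itself). For $F\in\mathcal F_j(P)$ let $\lambda_F$ be the $j$-dimensional Lebesgue measure restricted to $F$, and let $n(P,F)=N(P,F)\cap S^{d-1}$, where $N(P,F)$ is the normal cone of $P$ at $F$. Let $\wp_{m}^{d-1}$ be the set of $m$-dimensional spherical polytopes, i.e. the sets $C\cap S^{d-1}$ with $C$ a polyhedral convex cone of dimension $m+1$, with the Hausdorff metric; thus $n(P,F)\in\wp_{d-j-1}^{d-1}$ for $F\in\mathcal F_j(P)$, $j<d$. Let $V_j$ be the $j$-th intrinsic volume. **Theorem.** Let $\varphi$ be a local functional on $\mathcal P$ with local extension $\Phi$. 1. $\varphi$ has a unique representation $$\varphi(P)=\sum_{j=0}^{d-1}\varphi^{(j)}(P)+c_d\,V_d(P),\qquad P\in\mathcal P,$$ with $j$-homogeneous local functionals $\varphi^{(j)}$ and a constant $c_d\in\mathbb R$. 2. $\Phi$ has a unique representation $$\Phi(P,\cdot)=\sum_{j=0}^{d-1}\Phi^{(j)}(P,\cdot)+c_d\,\lambda(P\cap\cdot),\qquad P\in\mathcal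 P,$$ with $j$-homogeneous measure-valued functionals $\Phi^{(j)}$ and a constant $c_d$, and this constant is the same as in 1. 3. For each $j=0,\dots,d-1$ there is a unique function $f_j:\wp_{d-j-1}^{d-1}\to\mathbb R$ with $$\Phi^{(j)}(P,\cdot)=\sum_{F\in\mathcal F_j(P)}f_j(n(P,F))\,\lambda_F,\qquad P\in\mathcal P,$$ and $f_j$ is Borel measurable. 4. For $j=0,\dots,d-1$, $\Phi^{(j)}$ is a local extension of $\varphi^{(j)}$, and $$\varphi^{(j)}(P)=\sum_{F\in\mathcal F_j(P)}f_j(n(P,F))\,V_j(F),\qquad P\in\mathcal P.$$ 5. If $\Phi\ge 0$, then $c_d\ge0$, $f_j\ge 0$, $\Phi^{(j)}\ge0$ and $\varphi^{(j)}\ge 0$ for $j=0,\dots,d-1$, and $\varphi\ge0$. -/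

import Mathlib

open MeasureTheory TopologicalSpace Module
open scoped Pointwise RealInnerProductSpace

noncomputable section

/-- `ℝ^d` with its Euclidean structure. -/
abbrev E (d : ℕ) : Type := EuclideanSpace ℝ (Fin d)

/-- The Borel σ-algebra of the Hausdorff metric on non-empty compact sets. -/
instance instMeasurableSpaceNonemptyCompactsE (d : ℕ) : MeasurableSpace (NonemptyCompacts (E d)) :=
  borel _

instance instBorelSpaceNonemptyCompactsE (d : ℕ) : BorelSpace (NonemptyCompacts (E d)) := ⟨rfl⟩

/-- Convex polytopes in `ℝ^d`: non-empty compact sets that are convex hulls of finitely many points.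
As a subtype of `NonemptyCompacts`, this type carries the Hausdorff metric and its Borel
σ-algebra. -/
abbrev Polytope (d : ℕ) : Type :=
  {K : NonemptyCompacts (E d) // ∃ s : Finset (E d), (K : Set (E d)) = convexHull ℝ (s : Set (E d))}

namespace Polytope

variable {d : ℕ}

/-- The underlying set of a polytope. -/
abbrev carrier (P : Polytope d) : Set (E d) := (P.1 : Set (E d))

/-- The image of a polytope under a continuous affine map. -/
def map (f : E d →ᴬ[ℝ] E d) (P : Polytope d) : Polytope d :=
  ⟨P.1.map f f.continuous, by
    classical
    obtain ⟨s, hs⟩ := P.2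
    refine ⟨s.image f, ?_⟩
    rw [NonemptyCompacts.coe_map, hs, Finset.coe_image]
    exact (f : E d →ᵃ[ℝ] E d).image_convexHull (s : Set (E d))⟩

/-- The translate `P + x`. -/
def translate (P : Polytope d) (x : E d) : Polytope d :=
  P.map (ContinuousAffineMap.id ℝ (E d) + ContinuousAffineMap.const ℝ (E d) x)

/-- The dilate `α P`. -/
def dilate (α : ℝ) (P : Polytope d) : Polytope d :=
  P.map (α • ContinuousAffineMap.id ℝ (E d))

theorem carrier_translate (P : Polytope d) (x : E d) :
    (P.translate x).carrier = (fun y => y + x) '' P.carrier := rfl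

theorem carrier_dilate (α : ℝ) (P : Polytope d) : (P.dilate α).carrier = α • P.carrier := rfl

/-- The dimension of (the affine hull of) a polytope. -/
def dim (P : Polytope d) : ℕ := finrank ℝ (vectorSpan ℝ P.carrier)

/-- `F_j(P)`: the `j`-dimensional faces of `P`, i.e. the non-empty sets of maximizers over `P` of a
linear functional that have dimension `j`. The polytope `P` counts as a face of itself
(linear functional `0`). -/
def faces (j : ℕ) (P : Polytope d) : Set (Polytope d) :=
  {F | IsExposed ℝ P.carrier F.carrier ∧ F.dim = j}

theorem convex (P : Polytope d) : Convex ℝ P.carrier := by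
  obtain ⟨s, hs⟩ := P.2
  rw [carrier, hs]
  exact convex_convexHull ℝ _

theorem finite_faces (j : ℕ) (P : Polytope d) : (faces j P).Finite := by
  obtain ⟨s, hs⟩ := P.2
  refine Set.Finite.of_finite_image (f := fun F : Polytope d => F.carrier.extremePoints ℝ)
    ((s.finite_toSet.finite_subsets).subset ?_) ?_
  · rintro _ ⟨F, hF, rfl⟩
    refine (hF.1.isExtreme.extremePoints_subset_extremePoints).trans ?_
    rw [carrier, hs]
    exact extremePoints_convexHull_subset
  · intro F _ G _ h
    have hF := closure_convexHull_extremePoints F.1.isCompact F.convex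
    have hG := closure_convexHull_extremePoints G.1.isCompact G.convex
    have h' : F.carrier.extremePoints ℝ = G.carrier.extremePoints ℝ := h
    apply Subtype.ext
    apply SetLike.coe_injective
    change F.carrier = G.carrier
    exact hF.symm.trans ((congrArg (fun X => closure (convexHull ℝ X)) h').trans hG)

instance instFintypeFaces (j : ℕ) (P : Polytope d) : Fintype (faces j P) :=
  (finite_faces j P).fintype

/-- The normal cone `N(P, F)` of `P` at its face `F`: all `u` such that every point of `F`
maximizes `⟨u, ·⟩` over `P`. -/
def normalCone (P F : Polytope d) : Set (E d) :=
  {u | ∀ x ∈ F.carrier, ∀ y ∈ P.carrier, ⟪u, y⟫ ≤ ⟪u, x⟫}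

/-- `λ_F` for a `j`-dimensional face `F`: the `j`-dimensional Lebesgue measure restricted to `F`. -/
def faceMeasure (j : ℕ) (F : Polytope d) : Measure (E d) :=
  (Measure.euclideanHausdorffMeasure j).restrict F.carrier

/-- The external angle of `P` at a `j`-face `F`: the proportion of the unit ball in the linear span
of the normal cone `N(P, F)` (a space of dimension `d - j`) that is filled by `N(P, F)`. -/
def externalAngle (j : ℕ) (P F : Polytope d) : ℝ :=
  (Measure.euclideanHausdorffMeasure (d - j)).real
      (P.normalCone F ∩ Metric.closedBall 0 1) /
    (Measure.euclideanHausdorffMeasure (d - j)).real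
      ((Submodule.span ℝ (P.normalCone F) : Set (E d)) ∩ Metric.closedBall 0 1)

/-- The `j`-th intrinsic volume of a polytope: the sum over its `j`-faces of the external angle times
the `j`-dimensional volume of the face. -/
def intrinsicVolume (j : ℕ) (P : Polytope d) : ℝ :=
  ∑ F : faces j P, P.externalAngle j F.1 * (faceMeasure j F.1).real Set.univ

end Polytope

/-- Polyhedral cones: finite intersections of closed half-spaces with `0` in the boundary (or, for
`a = 0`, of the whole space). -/
def IsPolyhedralCone {d : ℕ} (C : Set (E d)) : Prop :=
  ∃ s : Finset (E d), C = {u | ∀ a ∈ s, ⟪a, u⟫ ≤ 0}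

/-- The `m`-dimensional spherical polytopes in the unit sphere of `ℝ^d`: intersections of the sphere
with a polyhedral cone of dimension `m + 1`. This type carries the Hausdorff metric and its Borel
σ-algebra. -/
abbrev SphericalPolytope (d m : ℕ) : Type :=
  {p : NonemptyCompacts (E d) // ∃ C : Set (E d), IsPolyhedralCone C ∧
    finrank ℝ (Submodule.span ℝ C) = m + 1 ∧ (p : Set (E d)) = C ∩ Metric.sphere 0 1}

namespace Polytope

variable {d : ℕ}

theorem isPolyhedralCone_normalCone (P F : Polytope d) : IsPolyhedralCone (P.normalCone F) := by
  classical
  obtain ⟨s, hs⟩ := P.2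
  obtain ⟨t, ht⟩ := F.2
  refine ⟨(s ×ˢ t).image (fun q => q.1 - q.2), ?_⟩
  ext u
  simp only [normalCone, Set.mem_ofPred_eq, Finset.mem_image, Finset.mem_product, Prod.exists,
    forall_exists_index, and_imp]
  constructor
  · rintro h _ y x hy hx rfl
    have hy' : y ∈ P.carrier := by rw [carrier, hs]; exact subset_convexHull ℝ _ hy
    have hx' : x ∈ F.carrier := by rw [carrier, ht]; exact subset_convexHull ℝ _ hx
    rw [real_inner_comm, inner_sub_right]
    linarith [h x hx' y hy']
  · intro h x hx y hy
    have h1 : ∀ x ∈ t, ∀ y ∈ s, ⟪u, y⟫ ≤ ⟪u, x⟫ := by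
      intro x hx y hy
      have := h _ y x hy hx rfl
      rw [real_inner_comm, inner_sub_right] at this
      linarith
    have h2 : ∀ x ∈ t, P.carrier ⊆ {y | ⟪u, y⟫ ≤ ⟪u, x⟫} := by
      intro x hx
      rw [carrier, hs]
      exact convexHull_min (fun y hy => h1 x hx y hy)
        (convex_halfSpace_le (innerSL ℝ u).isLinear _)
    have h3 : F.carrier ⊆ {x | ⟪u, y⟫ ≤ ⟪u, x⟫} := by
      rw [carrier, ht]
      exact convexHull_min (fun x hx => h2 x hx hy)
        (convex_halfSpace_ge (innerSL ℝ u).isLinear _)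
    exact h3 hx

theorem span_normalCone {P F : Polytope d} (h : IsExposed ℝ P.carrier F.carrier) :
    Submodule.span ℝ (P.normalCone F) = (vectorSpan ℝ F.carrier)ᗮ := by
  have hFP : F.carrier ⊆ P.carrier := h.subset
  obtain ⟨x₀, hx₀⟩ := F.1.nonempty
  obtain ⟨l, hl⟩ := h F.1.nonempty
  set u₀ : E d := (InnerProductSpace.toDual ℝ (E d)).symm l with hu₀
  have hlu : ∀ y, l y = ⟪u₀, y⟫ := fun y => by
    rw [hu₀, InnerProductSpace.toDual_symm_apply]
  have hF : ∀ x, x ∈ F.carrier ↔ x ∈ P.carrier ∧ ∀ y ∈ P.carrier, ⟪u₀, y⟫ ≤ ⟪u₀, x⟫ := by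
    intro x
    conv_lhs => rw [hl]
    simp [hlu]
  apply le_antisymm
  · rw [Submodule.span_le]
    intro u hu
    rw [SetLike.mem_coe, Submodule.mem_orthogonal']
    intro v hv
    rw [vectorSpan_def] at hv
    induction hv using Submodule.span_induction with
    | mem v hv =>
      obtain ⟨x, hx, y, hy, rfl⟩ := hv
      change ⟪u, x - y⟫ = 0
      rw [inner_sub_right]
      linarith [hu x hx y (hFP hy), hu y hy x (hFP hx)]
    | zero => simp
    | add a b _ _ ha hb => rw [inner_add_right, ha, hb, add_zero]
    | smul c a _ ha => rw [inner_smul_right, ha, mul_zero]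
  · intro w hw
    have hwF : ∀ x ∈ F.carrier, ∀ y ∈ F.carrier, ⟪w, x⟫ = ⟪w, y⟫ := by
      intro x hx y hy
      have := (Submodule.mem_orthogonal' _ _).1 hw _ (vsub_mem_vectorSpan ℝ hx hy)
      rw [vsub_eq_sub, inner_sub_right] at this
      linarith
    obtain ⟨s, hs⟩ := P.2
    have hev : ∀ᶠ ε : ℝ in nhdsWithin 0 (Set.Ioi 0), ∀ y ∈ s, ⟪u₀ + ε • w, y - x₀⟫ ≤ 0 := by
      rw [Filter.eventually_all_finset]
      intro y hy
      have hyP : y ∈ P.carrier := by rw [carrier, hs]; exact subset_convexHull ℝ _ hy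
      by_cases hyF : y ∈ F.carrier
      · refine Filter.Eventually.of_forall fun ε => le_of_eq ?_
        have h1 := ((hF y).1 hyF).2 x₀ (hFP hx₀)
        have h2 := ((hF x₀).1 hx₀).2 y hyP
        rw [inner_add_left, real_inner_smul_left, inner_sub_right, inner_sub_right,
          hwF y hyF x₀ hx₀]
        linarith
      · have hlt : ⟪u₀ + (0 : ℝ) • w, y - x₀⟫ < 0 := by
          rw [zero_smul, add_zero, inner_sub_right]
          by_contra hcon
          push Not at hcon
          exact hyF ((hF y).2 ⟨hyP, fun z hz =>
            (((hF x₀).1 hx₀).2 z hz).trans (by linarith)⟩)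
        have hcont : Continuous fun ε : ℝ => ⟪u₀ + ε • w, y - x₀⟫ := by fun_prop
        exact nhdsWithin_le_nhds
          ((hcont.continuousAt.eventually (gt_mem_nhds hlt)).mono fun _ hε => le_of_lt hε)
    obtain ⟨ε, hε, hεpos⟩ := (hev.and self_mem_nhdsWithin).exists
    have hεpos : (0 : ℝ) < ε := hεpos
    have hmem₀ : u₀ ∈ P.normalCone F := fun x hx y hy => ((hF x).1 hx).2 y hy
    have hmem : u₀ + ε • w ∈ P.normalCone F := by
      intro x hx y hy
      have h1 : P.carrier ⊆ {y | ⟪u₀ + ε • w, y⟫ ≤ ⟪u₀ + ε • w, x₀⟫} := by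
        rw [carrier, hs]
        refine convexHull_min (fun y hy => ?_)
          (convex_halfSpace_le (innerSL ℝ (u₀ + ε • w)).isLinear _)
        have := hε y hy
        rw [inner_sub_right] at this
        simp only [Set.mem_ofPred_eq]
        linarith
      have h2 : ⟪u₀ + ε • w, y⟫ ≤ ⟪u₀ + ε • w, x₀⟫ := h1 hy
      have h3 : ⟪u₀ + ε • w, x₀⟫ = ⟪u₀ + ε • w, x⟫ := by
        have h4 := ((hF x).1 hx).2 x₀ (hFP hx₀)
        have h5 := ((hF x₀).1 hx₀).2 x (hFP hx)
        rw [inner_add_left, inner_add_left, real_inner_smul_left, real_inner_smul_left,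
          hwF x hx x₀ hx₀]
        linarith
      exact h2.trans h3.le
    have hw' : w = ε⁻¹ • ((u₀ + ε • w) - u₀) := by
      rw [add_sub_cancel_left, smul_smul, inv_mul_cancel₀ hεpos.ne', one_smul]
    rw [hw']
    exact Submodule.smul_mem _ _
      (Submodule.sub_mem _ (Submodule.subset_span hmem) (Submodule.subset_span hmem₀))

theorem finrank_span_normalCone {j : ℕ} {P F : Polytope d} (hj : j < d) (h : F ∈ faces j P) :
    finrank ℝ (Submodule.span ℝ (P.normalCone F)) = (d - 1 - j) + 1 := by
  have h1 := Submodule.finrank_add_finrank_orthogonal (vectorSpan ℝ F.carrier)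
  have h2 : finrank ℝ (vectorSpan ℝ F.carrier) = j := h.2
  rw [finrank_euclideanSpace_fin, h2, ← span_normalCone h.1] at h1
  omega

/-- `n(P, F)`: the spherical polytope of dimension `d - j - 1` in which the normal cone of `P` at its
`j`-face `F` meets the unit sphere. -/
def normalImage {j : Fin d} (P : Polytope d) (F : faces (j : ℕ) P) :
    SphericalPolytope d (d - 1 - j) :=
  ⟨⟨⟨P.normalCone F.1 ∩ Metric.sphere 0 1, by
      refine (isCompact_sphere _ _).inter_left ?_
      simp only [normalCone, Set.ofPred_forall]
      exact isClosed_biInter fun x _ => isClosed_biInter fun y _ =>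
        isClosed_le (by fun_prop) (by fun_prop)⟩, by
      have h1 := finrank_span_normalCone j.2 F.2
      obtain ⟨u, hu, hu0⟩ : ∃ u ∈ P.normalCone F.1, u ≠ 0 := by
        by_contra hcon
        push Not at hcon
        have h2 : Submodule.span ℝ (P.normalCone F.1) = ⊥ := Submodule.span_eq_bot.2 hcon
        rw [h2, finrank_bot] at h1
        omega
      refine ⟨‖u‖⁻¹ • u, fun x hx y hy => ?_, ?_⟩
      · rw [real_inner_smul_left, real_inner_smul_left]
        exact mul_le_mul_of_nonneg_left (hu x hx y hy) (by positivity)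
      · rw [mem_sphere_zero_iff_norm, norm_smul, norm_inv, norm_norm,
          inv_mul_cancel₀ (norm_ne_zero_iff.2 hu0)]⟩,
    P.normalCone F.1, isPolyhedralCone_normalCone P F.1, finrank_span_normalCone j.2 F.2, rfl⟩

end Polytope

variable {d : ℕ}

/-- `Φ` is a local extension of `φ`: a measurable kernel of finite signed Borel measures with total
mass `φ` that is translation covariant and locally determined. -/
structure IsLocalExtension (φ : Polytope d → ℝ) (Φ : Polytope d → SignedMeasure (E d)) : Prop where
  measurable : ∀ A, MeasurableSet A → Measurable fun P => Φ P A
  total : ∀ P, φ P = Φ P Set.univ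
  translation_covariant : ∀ (P : Polytope d) (A : Set (E d)) (x : E d), MeasurableSet A →
    Φ (P.translate x) ((fun y => y + x) '' A) = Φ P A
  locally_determined : ∀ (P Q : Polytope d) (A U : Set (E d)), MeasurableSet A → IsOpen U →
    P.carrier ∩ U = Q.carrier ∩ U → A ⊆ U → Φ P A = Φ Q A

/-- A functional on polytopes is local if it has a local extension. -/
def IsLocal (φ : Polytope d → ℝ) : Prop := ∃ Φ, IsLocalExtension φ Φ

/-- `k`-homogeneity of real functionals, for positive dilation factors. -/
def IsHomogeneous (k : ℕ) (φ : Polytope d → ℝ) : Prop :=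
  ∀ (α : ℝ) (P : Polytope d), 0 < α → φ (P.dilate α) = α ^ k * φ P

/-- `k`-homogeneity of measure-valued functionals, for positive dilation factors. -/
def IsMeasureHomogeneous (k : ℕ) (Φ : Polytope d → SignedMeasure (E d)) : Prop :=
  ∀ (α : ℝ) (P : Polytope d) (A : Set (E d)), 0 < α → MeasurableSet A →
    Φ (P.dilate α) (α • A) = α ^ k * Φ P A

/-- `φ = ∑_{j<d} ψ_j + c V_d` with `j`-homogeneous local functionals `ψ_j`. -/
def IsDecomposition (φ : Polytope d → ℝ) (ψ : Fin d → Polytope d → ℝ) (c : ℝ) : Prop :=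
  (∀ j : Fin d, IsLocal (ψ j) ∧ IsHomogeneous (j : ℕ) (ψ j)) ∧
    ∀ P, φ P = ∑ j, ψ j P + c * volume.real P.carrier

/-- `Φ(P, ·) = ∑_{j<d} Ψ_j(P, ·) + c λ(P ∩ ·)` with `j`-homogeneous measure-valued functionals
`Ψ_j`. -/
def IsMeasureDecomposition (Φ : Polytope d → SignedMeasure (E d))
    (Ψ : Fin d → Polytope d → SignedMeasure (E d)) (c : ℝ) : Prop :=
  (∀ j : Fin d, IsMeasureHomogeneous (j : ℕ) (Ψ j)) ∧
    ∀ (P : Polytope d) (A : Set (E d)), MeasurableSet A →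
      Φ P A = ∑ j, Ψ j P A + c * volume.real (P.carrier ∩ A)

/-- `Ψ(P, ·) = ∑_{F ∈ F_j(P)} f(n(P, F)) λ_F` for all polytopes `P`. -/
def IsFaceSum (j : Fin d) (Ψ : Polytope d → SignedMeasure (E d))
    (f : SphericalPolytope d (d - 1 - j) → ℝ) : Prop :=
  ∀ (P : Polytope d) (A : Set (E d)), MeasurableSet A →
    Ψ P A = ∑ F : Polytope.faces (j : ℕ) P,
      f (P.normalImage F) * (Polytope.faceMeasure (j : ℕ) F.1).real A

end

/-! Near the relative interior of a face `F`, the polytope `P` coincides with a translate of the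
polar of `N(P, F)` (`exists_isOpen_openFace_subset`). Locality and translation covariance therefore
make `Φ(P, ·)` on relint `F` invariant under shifts along `F` and dependent only on the normal cone.
So it is a multiple of `λ_F` whose factor is a function of `n(P, F)`. This is
`apply_of_subset_openFace`, proved by computing one integral over translations in two ways.

Off `P` the measure vanishes, because otherwise infinitely many disjoint translates would carry the
same non-zero mass. As `P` is the disjoint union of its open faces, `Φ(P, ·)` is the sum over `j` of
the face sums `faceSum Φ j P` (`apply_eq_sum_faceSum`). Full-dimensional polytopes all have normal
cone `{0}` at themselves, so the top term is a constant times Lebesgue measure.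

Dilation keeps normal cones and scales `λ_F` by `α ^ j`, so `Φ(αP, αA)` is a polynomial in `α`.
Comparing coefficients gives uniqueness, and inverting a Vandermonde matrix writes each `j`-part as
a fixed combination of values of `Φ` at dilates (`exists_faceSum_eq`), from which it inherits
measurability and locality.

For `f_j`, each spherical polytope `p` is the normal image of a face of a polytope depending
continuously on `p`: the polar of its cone, cut by a cube. Evaluating there on a small ball isolates
`f_j p` (`IsFaceSum.eq_div`), which gives uniqueness and measurability. -/

/-! ### Polytopes as convex hulls and as intersections of half-spaces. -/

/-- A compact set cut out by finitely many affine inequalities is the convex hull of a finite set. -/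
theorem exists_eq_convexHull_of_isCompact {V ι : Type*} [NormedAddCommGroup V] [NormedSpace ℝ V]
    [Finite ι] (a : ι → V →L[ℝ] ℝ) (b : ι → ℝ) (h : IsCompact {x | ∀ i, a i x ≤ b i}) :
    ∃ t : Finset V, {x | ∀ i, a i x ≤ b i} = convexHull ℝ (t : Set V) := by
  have hconv : Convex ℝ {x | ∀ i, a i x ≤ b i} := by
    rw [Set.ofPred_forall]
    exact convex_iInter fun i => convex_halfSpace_le (a i).isLinear _
  have hfin : (Set.extremePoints ℝ {x | ∀ i, a i x ≤ b i}).Finite := by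
    -- An extreme point is determined by its set of active constraints: if `y` has the same set as
    -- `x`, the segment from `y` can be prolonged beyond `x`, so `x` is extreme only if `x = y`.
    refine Set.Finite.of_finite_image (f := fun x => {i | a i x = b i}) (Set.toFinite _) ?_
    intro x hx y hy hxy
    have hact : ∀ i, a i x = b i → a i (x - y) = 0 := fun i hi => by
      have : a i y = b i := (Set.ext_iff.1 hxy i).1 hi
      rw [map_sub, hi, this, sub_self]
    have hev : ∀ᶠ ε : ℝ in nhdsWithin 0 (Set.Ioi 0), ∀ i,
        a i (x + ε • (x - y)) ≤ b i := by
      rw [Filter.eventually_all]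
      intro i
      rcases (hx.1 i).eq_or_lt with hi | hi
      · refine Filter.Eventually.of_forall fun ε => ?_
        rw [map_add, map_smul, hact i hi, smul_zero, add_zero, hi]
      · have hc : Continuous fun ε : ℝ => a i (x + ε • (x - y)) := by fun_prop
        refine nhdsWithin_le_nhds ((hc.continuousAt.eventually (gt_mem_nhds ?_)).mono
          fun _ => le_of_lt)
        simpa using hi
    obtain ⟨ε, hε, hε0⟩ := (hev.and self_mem_nhdsWithin).exists
    have hε0 : (0 : ℝ) < ε := hε0
    have hmem : x ∈ openSegment ℝ y (x + ε • (x - y)) := by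
      refine ⟨ε / (1 + ε), 1 / (1 + ε), by positivity, by positivity, by field_simp; ring, ?_⟩
      match_scalars
      · field_simp
        ring
      · field_simp
    exact (hx.2 hy.1 hε hmem).symm
  refine ⟨hfin.toFinset, ?_⟩
  have := closure_convexHull_extremePoints h hconv
  rw [(hfin.isClosed_convexHull _).closure_eq] at this
  rw [hfin.coe_toFinset, this]

/-- The cube `[-1, 1]^d`. -/
def unitCube (d : ℕ) : Set (E d) := {x | ∀ i, |x i| ≤ 1}

theorem isCompact_unitCube (d : ℕ) : IsCompact (unitCube d) := by
  have h : unitCube d = (EuclideanSpace.equiv (Fin d) ℝ).toHomeomorph ⁻¹'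
      (Set.pi Set.univ fun _ => Set.Icc (-1) 1) := by
    ext x
    simp only [unitCube, abs_le, Set.mem_ofPred_eq, Set.mem_preimage, Set.mem_univ_pi, Set.mem_Icc]
    rfl
  rw [h, Homeomorph.isCompact_preimage]
  exact isCompact_univ_pi fun _ => isCompact_Icc

theorem closedBall_subset_unitCube (d : ℕ) {r : ℝ} (hr : r ≤ 1) :
    Metric.closedBall (0 : E d) r ⊆ unitCube d := fun x hx i => by
  rw [mem_closedBall_zero_iff] at hx
  exact ((PiLp.norm_apply_le x i).trans hx).trans hr

theorem sphere_subset_unitCube (d : ℕ) : Metric.sphere (0 : E d) 1 ⊆ unitCube d :=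
  Metric.sphere_subset_closedBall.trans (closedBall_subset_unitCube d le_rfl)

/-- The part of the unit cube cut out by finitely many affine inequalities is the convex hull of a
finite set. -/
theorem exists_eq_convexHull_inter_unitCube {d : ℕ} (I : Finset (E d × ℝ)) :
    ∃ t : Finset (E d), {x | ∀ q ∈ I, ⟪q.1, x⟫ ≤ q.2} ∩ unitCube d = convexHull ℝ (t : Set (E d)) := by
  let a : I ⊕ (Fin d ⊕ Fin d) → E d →L[ℝ] ℝ :=
    Sum.elim (fun q => innerSL ℝ q.1.1) (Sum.elim (fun i => EuclideanSpace.proj i)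
      (fun i => -EuclideanSpace.proj i))
  let b : I ⊕ (Fin d ⊕ Fin d) → ℝ := Sum.elim (fun q => q.1.2) (fun _ => 1)
  have hab : {x | ∀ q ∈ I, ⟪q.1, x⟫ ≤ q.2} ∩ unitCube d = {x | ∀ i, a i x ≤ b i} := by
    ext x
    simp [a, b, unitCube, abs_le', forall_and]
  rw [hab]
  refine exists_eq_convexHull_of_isCompact a b ?_
  rw [← hab]
  refine (isCompact_unitCube d).inter_left ?_
  simp only [Set.ofPred_forall]
  exact isClosed_biInter fun q _ => isClosed_le (by fun_prop) (by fun_prop)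

/-- The convex hull of a finite set is cut out by finitely many affine inequalities. -/
theorem exists_convexHull_eq_halfSpaces {d : ℕ} (s : Finset (E d)) :
    ∃ I : Finset (E d × ℝ), convexHull ℝ (s : Set (E d)) = {x | ∀ q ∈ I, ⟪q.1, x⟫ ≤ q.2} := by
  classical
  -- The pairs `(u, c)` with `⟪u, ·⟫ ≤ c` on `s` form a cone. Cut by a cube it is compact, and a
  -- finite set spanning this section supplies the half-spaces.
  let a : s ⊕ ((Fin d ⊕ Fin d) ⊕ (Unit ⊕ Unit)) → (E d × ℝ) →L[ℝ] ℝ :=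
    Sum.elim (fun v => (innerSL ℝ v.1).comp (.fst ℝ _ _) - .snd ℝ _ _)
      (Sum.elim (Sum.elim (fun i => (EuclideanSpace.proj i).comp (.fst ℝ _ _))
        (fun i => -(EuclideanSpace.proj i).comp (.fst ℝ (E d) ℝ)))
        (Sum.elim (fun _ => .snd ℝ _ _) (fun _ => -.snd ℝ _ _)))
  let b : s ⊕ ((Fin d ⊕ Fin d) ⊕ (Unit ⊕ Unit)) → ℝ := Sum.elim 0 1
  have hab : {q : E d × ℝ | ∀ i, a i q ≤ b i} =
      {q | ∀ v ∈ s, ⟪q.1, v⟫ ≤ q.2} ∩ unitCube d ×ˢ Set.Icc (-1) 1 := by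
    ext q
    simp [a, b, unitCube, abs_le', forall_and, real_inner_comm, neg_le]
    tauto
  have hcpt : IsCompact {q : E d × ℝ | ∀ i, a i q ≤ b i} := by
    rw [hab]
    refine ((isCompact_unitCube d).prod isCompact_Icc).inter_left ?_
    simp only [Set.ofPred_forall]
    exact isClosed_biInter fun q _ => isClosed_le (by fun_prop) (by fun_prop)
  obtain ⟨t, ht⟩ := exists_eq_convexHull_of_isCompact a b hcpt
  rw [hab] at ht
  refine ⟨t, Set.Subset.antisymm ?_ ?_⟩
  · refine convexHull_min ?_ ?_
    · intro v hv q hq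
      have h1 : q ∈ convexHull ℝ (t : Set (E d × ℝ)) := subset_convexHull ℝ _ hq
      rw [← ht] at h1
      exact h1.1 v hv
    · simp only [Set.ofPred_forall]
      exact convex_iInter₂ fun q _ => convex_halfSpace_le (innerSL ℝ q.1).isLinear _
  · intro x hx
    by_contra hxs
    obtain ⟨f, c, hf, hc⟩ := geometric_hahn_banach_closed_point (convex_convexHull ℝ (s : Set (E d)))
      (s.finite_toSet.isClosed_convexHull ℝ) hxs
    set u : E d := (InnerProductSpace.toDual ℝ (E d)).symm f with hu
    have hfu : ∀ y, f y = ⟪u, y⟫ := fun y => by rw [hu, InnerProductSpace.toDual_symm_apply]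
    -- Scaling by `k` moves the separating pair `(u, c)` into the cube, where it is a convex
    -- combination of inequalities that `x` satisfies.
    set k : ℝ := (‖u‖ + |c| + 1)⁻¹ with hk
    have hk0 : 0 < k := by positivity
    have hk1 : k * (‖u‖ + |c| + 1) = 1 := inv_mul_cancel₀ (by positivity)
    have hmem : (k • u, k * c) ∈ convexHull ℝ (t : Set (E d × ℝ)) := by
      rw [← ht]
      refine ⟨fun v hv => ?_, ?_, ?_⟩
      · have := hf v (subset_convexHull ℝ _ hv)
        rw [hfu] at this
        simp only [real_inner_smul_left]
        exact mul_le_mul_of_nonneg_left this.le hk0.le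
      · apply closedBall_subset_unitCube d le_rfl
        rw [mem_closedBall_zero_iff, norm_smul, Real.norm_of_nonneg hk0.le]
        nlinarith [abs_nonneg c]
      · rw [Set.mem_Icc, ← abs_le, abs_mul, abs_of_pos hk0]
        nlinarith [norm_nonneg u]
    have hsub : convexHull ℝ (t : Set (E d × ℝ)) ⊆ {q | ⟪q.1, x⟫ ≤ q.2} := by
      refine convexHull_min (fun q hq => hx q hq) ?_
      have := convex_halfSpace_le (𝕜 := ℝ)
        ((innerSL ℝ x).comp (.fst ℝ (E d) ℝ) - .snd ℝ (E d) ℝ).isLinear 0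
      convert this using 2
      simp [real_inner_comm]
    have h2 := hsub hmem
    simp only [Set.mem_ofPred_eq, real_inner_smul_left] at h2
    rw [hfu] at hc
    exact absurd (le_of_mul_le_mul_left h2 hk0) (not_le.2 hc)

/-! ### Faces, normal cones and the local shape of a polytope. -/

namespace Polytope

variable {d : ℕ}

theorem exists_halfSpaces (P : Polytope d) :
    ∃ I : Finset (E d × ℝ), P.carrier = {x | ∀ q ∈ I, ⟪q.1, x⟫ ≤ q.2} := by
  obtain ⟨s, hs⟩ := P.2
  obtain ⟨I, hI⟩ := exists_convexHull_eq_halfSpaces s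
  exact ⟨I, hs.trans hI⟩

theorem isCompact (P : Polytope d) : IsCompact P.carrier := P.1.isCompact

theorem nonempty (P : Polytope d) : P.carrier.Nonempty := P.1.nonempty

theorem ext {P Q : Polytope d} (h : P.carrier = Q.carrier) : P = Q :=
  Subtype.ext (SetLike.coe_injective h)

theorem measurableSet (P : Polytope d) : MeasurableSet P.carrier := P.isCompact.measurableSet

/-- The normal cone of `P` at a point: all linear functionals that attain their maximum over `P`
at `x`. -/
def normalConeAt (P : Polytope d) (x : E d) : Set (E d) :=
  {u | ∀ y ∈ P.carrier, ⟪u, y⟫ ≤ ⟪u, x⟫}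

/-- The points of `P` whose normal cone is that of the face `F`; this is the relative interior
of `F`. -/
def openFace (P F : Polytope d) : Set (E d) :=
  {x ∈ P.carrier | P.normalConeAt x = P.normalCone F}

theorem normalCone_subset {P F : Polytope d} {x : E d} (hx : x ∈ F.carrier) :
    P.normalCone F ⊆ P.normalConeAt x := fun _ hu y hy => hu x hx y hy

/-- Normal cones are governed by active constraints: if those active at `x` are active at `y`, then
`x + ε • (x - y)` stays in `P` for small `ε > 0`, so a functional maximal at `x` cannot be smaller
at `y`. -/
theorem normalConeAt_subset_iff {P : Polytope d} {I : Finset (E d × ℝ)}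
    (hI : P.carrier = {x | ∀ q ∈ I, ⟪q.1, x⟫ ≤ q.2}) {x y : E d} (hx : x ∈ P.carrier)
    (hy : y ∈ P.carrier) : P.normalConeAt x ⊆ P.normalConeAt y ↔
      ∀ q ∈ I, ⟪q.1, x⟫ = q.2 → ⟪q.1, y⟫ = q.2 := by
  have hI' : ∀ z, z ∈ P.carrier ↔ ∀ q ∈ I, ⟪q.1, z⟫ ≤ q.2 := fun z => by rw [hI]; rfl
  constructor
  · intro h q hq hqx
    have h1 : q.1 ∈ P.normalConeAt x := fun z hz => hqx ▸ (hI' z).1 hz q hq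
    exact le_antisymm ((hI' y).1 hy q hq) (hqx ▸ h h1 x hx)
  · intro h u hu
    have hev : ∀ᶠ ε : ℝ in nhdsWithin 0 (Set.Ioi 0), ∀ q ∈ I, ⟪q.1, x + ε • (x - y)⟫ ≤ q.2 := by
      rw [Filter.eventually_all_finset]
      intro q hq
      rcases ((hI' x).1 hx q hq).eq_or_lt with hi | hi
      · refine Filter.Eventually.of_forall fun ε => ?_
        rw [inner_add_right, inner_smul_right, inner_sub_right, h q hq hi, hi, sub_self, mul_zero,
          add_zero]
      · have hc : Continuous fun ε : ℝ => ⟪q.1, x + ε • (x - y)⟫ := by fun_prop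
        refine nhdsWithin_le_nhds ((hc.continuousAt.eventually (gt_mem_nhds ?_)).mono
          fun _ => le_of_lt)
        simpa using hi
    obtain ⟨ε, hε, hε0⟩ := (hev.and self_mem_nhdsWithin).exists
    have hε0 : (0 : ℝ) < ε := hε0
    have h1 := hu _ ((hI' _).2 hε)
    rw [inner_add_right, inner_smul_right, inner_sub_right] at h1
    have h2 : ⟪u, x⟫ ≤ ⟪u, y⟫ := by
      have : ε * (⟪u, x⟫ - ⟪u, y⟫) ≤ 0 := by linarith
      have := nonpos_of_mul_nonpos_right this hε0
      linarith
    exact fun z hz => (hu z hz).trans h2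

/-- Near each of its points, a polytope is the translate of the polar of the normal cone. -/
theorem exists_isOpen_inter_eq (P : Polytope d) {x : E d} (hx : x ∈ P.carrier) :
    ∃ U, IsOpen U ∧ x ∈ U ∧
      P.carrier ∩ U = {y | ∀ u ∈ P.normalConeAt x, ⟪u, y - x⟫ ≤ 0} ∩ U := by
  obtain ⟨I, hI⟩ := P.exists_halfSpaces
  have hI' : ∀ z, z ∈ P.carrier ↔ ∀ q ∈ I, ⟪q.1, z⟫ ≤ q.2 := fun z => by rw [hI]; rfl
  -- Constraints inactive at `x` stay satisfied nearby; the active ones have their normals in the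
  -- normal cone at `x`.
  have hev : ∀ᶠ y in nhds x, ∀ q ∈ I, ⟪q.1, x⟫ < q.2 → ⟪q.1, y⟫ ≤ q.2 := by
    rw [Filter.eventually_all_finset]
    intro q _
    by_cases hq : ⟪q.1, x⟫ < q.2
    · have hc : Continuous fun y : E d => ⟪q.1, y⟫ := by fun_prop
      exact (hc.continuousAt.eventually (gt_mem_nhds hq)).mono fun _ h _ => le_of_lt h
    · exact Filter.Eventually.of_forall fun _ h => absurd h hq
  obtain ⟨U, hU, hUo, hxU⟩ := eventually_nhds_iff.1 hev
  refine ⟨U, hUo, hxU, ?_⟩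
  ext y
  refine and_congr_left fun hyU => ⟨fun hy u hu => ?_, fun hy => ?_⟩
  · rw [inner_sub_right]
    linarith [hu y hy]
  · rw [hI']
    intro q hq
    rcases ((hI' x).1 hx q hq).eq_or_lt with hi | hi
    · have : q.1 ∈ P.normalConeAt x := fun z hz => hi ▸ (hI' z).1 hz q hq
      have := hy _ this
      rw [inner_sub_right] at this
      linarith
    · exact hU y hyU q hq hi

/-- The functional exposing `F` lies in the normal cone of `F`, so a point whose normal cone
contains that cone maximizes it. Faces can thus be compared through their normal cones. -/
theorem mem_carrier_iff_of_isExposed {P F : Polytope d} (h : IsExposed ℝ P.carrier F.carrier)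
    {y : E d} : y ∈ F.carrier ↔ y ∈ P.carrier ∧ P.normalCone F ⊆ P.normalConeAt y := by
  refine ⟨fun hy => ⟨h.subset hy, normalCone_subset hy⟩, fun ⟨hyP, hy⟩ => ?_⟩
  obtain ⟨l, hl⟩ := h F.nonempty
  set u₀ : E d := (InnerProductSpace.toDual ℝ (E d)).symm l with hu₀
  have hlu : ∀ y, l y = ⟪u₀, y⟫ := fun y => by rw [hu₀, InnerProductSpace.toDual_symm_apply]
  have hF : ∀ x, x ∈ F.carrier ↔ x ∈ P.carrier ∧ ∀ y ∈ P.carrier, ⟪u₀, y⟫ ≤ ⟪u₀, x⟫ := by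
    intro x
    conv_lhs => rw [hl]
    simp [hlu]
  exact (hF y).2 ⟨hyP, hy fun x hx => ((hF x).1 hx).2⟩

theorem openFace_subset {P F : Polytope d} (h : IsExposed ℝ P.carrier F.carrier) :
    P.openFace F ⊆ F.carrier := fun _ hx =>
  (mem_carrier_iff_of_isExposed h).2 ⟨hx.1, hx.2.superset⟩

theorem eq_of_normalCone_eq {P F G : Polytope d} (hF : IsExposed ℝ P.carrier F.carrier)
    (hG : IsExposed ℝ P.carrier G.carrier) (h : P.normalCone F = P.normalCone G) : F = G := by
  apply Polytope.ext
  ext x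
  rw [mem_carrier_iff_of_isExposed hF, mem_carrier_iff_of_isExposed hG, h]

theorem openFace_nonempty {P F : Polytope d} (h : IsExposed ℝ P.carrier F.carrier) :
    (P.openFace F).Nonempty := by
  classical
  obtain ⟨I, hI⟩ := P.exists_halfSpaces
  let act : E d → Finset (E d × ℝ) := fun x => I.filter fun q => ⟪q.1, x⟫ = q.2
  -- A point of `F` with the fewest active constraints works: at its midpoint with any `y` in `F`
  -- only constraints active at both are active, so by minimality those active at `x` are active at
  -- `y`.
  obtain ⟨x, hx, hmin⟩ := WellFounded.has_min (measure fun x => (act x).card).wf F.carrier F.nonempty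
  refine ⟨x, h.subset hx, Set.Subset.antisymm ?_ (normalCone_subset hx)⟩
  intro u hu y hy
  refine (normalConeAt_subset_iff hI (h.subset hx) (h.subset hy)).2 ?_ hu
  intro q hq hqx
  set z : E d := (1 / 2 : ℝ) • x + (1 / 2 : ℝ) • y with hz
  have hzF : z ∈ F.carrier := F.convex hx hy (by norm_num) (by norm_num) (by norm_num)
  have hI' : ∀ z ∈ P.carrier, ∀ q ∈ I, ⟪q.1, z⟫ ≤ q.2 := fun z hz => by rw [hI] at hz; exact hz
  have hzq : ∀ q ∈ I, ⟪q.1, z⟫ = q.2 → ⟪q.1, x⟫ = q.2 ∧ ⟪q.1, y⟫ = q.2 := by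
    intro q hq h1
    rw [hz, inner_add_right, inner_smul_right, inner_smul_right] at h1
    have h2 := hI' x (h.subset hx) q hq
    have h3 := hI' y (h.subset hy) q hq
    constructor <;> linarith
  have hsub : act z ⊆ act x := fun q hq => by
    simp only [act, Finset.mem_filter] at hq ⊢
    exact ⟨hq.1, (hzq q hq.1 hq.2).1⟩
  have heq : act z = act x := Finset.eq_of_subset_of_card_le hsub (not_lt.1 (hmin z hzF))
  have hqz : q ∈ act z := heq ▸ Finset.mem_filter.2 ⟨hq, hqx⟩
  exact (hzq q hq (Finset.mem_filter.1 hqz).2).2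

/-- Every point of `P` lies in the relative interior of some face. -/
theorem exists_mem_openFace (P : Polytope d) {x : E d} (hx : x ∈ P.carrier) :
    ∃ F : Polytope d, IsExposed ℝ P.carrier F.carrier ∧ x ∈ P.openFace F := by
  classical
  obtain ⟨I, hI⟩ := P.exists_halfSpaces
  have hI' : ∀ z, z ∈ P.carrier ↔ ∀ q ∈ I, ⟪q.1, z⟫ ≤ q.2 := fun z => by rw [hI]; rfl
  let J : Finset (E d × ℝ) := I.filter fun q => ⟪q.1, x⟫ = q.2
  let a : I ⊕ J → E d →L[ℝ] ℝ := Sum.elim (fun q => innerSL ℝ q.1.1) (fun q => -innerSL ℝ q.1.1)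
  let b : I ⊕ J → ℝ := Sum.elim (fun q => q.1.2) (fun q => -q.1.2)
  set S : Set (E d) := {y ∈ P.carrier | ∀ q ∈ J, ⟪q.1, y⟫ = q.2} with hS
  have hJ : ∀ q ∈ J, q ∈ I := fun q hq => (Finset.mem_filter.1 hq).1
  have hab : S = {y | ∀ i, a i y ≤ b i} := by
    ext y
    simp only [hS, Set.mem_ofPred_eq, hI', Sum.forall, a, b, Sum.elim_inl, Sum.elim_inr,
      Subtype.forall, innerSL_apply_apply, neg_le_neg_iff, neg_apply]
    exact and_congr_right fun h1 => forall₂_congr fun q hq =>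
      ⟨fun h => h.ge, fun h => le_antisymm (h1 q (hJ q hq)) h⟩
  have hcpt : IsCompact S := by
    have : S = P.carrier ∩ {y | ∀ q ∈ J, ⟪q.1, y⟫ = q.2} := rfl
    rw [this]
    refine P.isCompact.inter_right ?_
    simp only [Set.ofPred_forall]
    exact isClosed_biInter fun q _ => isClosed_eq (by fun_prop) (by fun_prop)
  have hxS : x ∈ S := ⟨hx, fun q hq => (Finset.mem_filter.1 hq).2⟩
  let F : Polytope d := ⟨⟨⟨S, hcpt⟩, ⟨x, hxS⟩⟩, by
    obtain ⟨t, ht⟩ := exists_eq_convexHull_of_isCompact a b (hab ▸ hcpt)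
    exact ⟨t, hab.trans ht⟩⟩
  have hF : F.carrier = S := rfl
  have hexp : IsExposed ℝ P.carrier F.carrier := by
    intro _
    -- Each summand is bounded on `P` by its own right-hand side, so the sum is maximal exactly
    -- where all constraints active at `x` are tight.
    refine ⟨∑ q ∈ J, innerSL ℝ q.1, ?_⟩
    have hle : ∀ z ∈ P.carrier, ∑ q ∈ J, ⟪q.1, z⟫ ≤ ∑ q ∈ J, q.2 := fun z hz =>
      Finset.sum_le_sum fun q hq => (hI' z).1 hz q (hJ q hq)
    ext y
    simp only [hF, hS, Set.mem_ofPred_eq, sum_apply, innerSL_apply_apply]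
    refine and_congr_right fun hy => ⟨fun h z hz => ?_, fun h => ?_⟩
    · rw [Finset.sum_congr rfl h]
      exact hle z hz
    · have h1 := h x hx
      rw [Finset.sum_congr rfl hxS.2] at h1
      exact (Finset.sum_eq_sum_iff_of_le fun q hq => (hI' y).1 hy q (hJ q hq)).1
        (le_antisymm (hle y hy) h1)
  refine ⟨F, hexp, hx, Set.Subset.antisymm ?_ (normalCone_subset hxS)⟩
  intro u hu y hy
  exact (normalConeAt_subset_iff hI hx hy.1).2
    (fun q hq hqx => hy.2 q (Finset.mem_filter.2 ⟨hq, hqx⟩)) hu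

theorem pairwise_disjoint_openFace {P F G : Polytope d} (hF : IsExposed ℝ P.carrier F.carrier)
    (hG : IsExposed ℝ P.carrier G.carrier) (h : F ≠ G) : Disjoint (P.openFace F) (P.openFace G) :=
  Set.disjoint_left.2 fun _ hx hy => h (eq_of_normalCone_eq hF hG (hx.2.symm.trans hy.2))

/-- Near the relative interior of a face, a polytope is a translate of the polar of the normal
cone at the face. -/
theorem exists_isOpen_openFace_subset {P F : Polytope d} (h : IsExposed ℝ P.carrier F.carrier) :
    ∃ U, IsOpen U ∧ P.openFace F ⊆ U ∧ ∀ x ∈ F.carrier,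
      P.carrier ∩ U = {y | ∀ u ∈ P.normalCone F, ⟪u, y - x⟫ ≤ 0} ∩ U := by
  choose! U hUo hxU hU using fun x (hx : x ∈ P.carrier) => P.exists_isOpen_inter_eq hx
  refine ⟨⋃ x ∈ P.openFace F, U x, isOpen_biUnion fun x hx => hUo x hx.1,
    fun x hx => Set.mem_biUnion hx (hxU x hx.1), fun x hx => ?_⟩
  rw [Set.inter_iUnion₂, Set.inter_iUnion₂]
  refine Set.iUnion₂_congr fun z hz => ?_
  rw [hU z hz.1, hz.2]
  congr 1
  ext y
  refine forall₂_congr fun u hu => ?_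
  -- Elements of the normal cone are constant on `F`, so the base point of the polar may be any
  -- point of `F`.
  have h1 := hu x hx z hz.1
  have h2 := hu z (openFace_subset h hz) x (h.subset hx)
  rw [inner_sub_right, inner_sub_right, le_antisymm h1 h2]

end Polytope

/-! ### Lebesgue measure on faces and their relative interiors. -/

section Hausdorff

variable {d : ℕ}

theorem isometry_add_coe (V : Submodule ℝ (E d)) (x : E d) : Isometry fun v : V => x + (v : E d) :=
  Isometry.of_dist_eq fun v w => by rw [dist_add_left, Subtype.dist_eq]

theorem mem_range_add_coe {V : Submodule ℝ (E d)} {x y : E d} :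
    y ∈ Set.range (fun v : V => x + (v : E d)) ↔ y - x ∈ V :=
  ⟨by rintro ⟨v, rfl⟩; simp, fun h => ⟨⟨y - x, h⟩, by simp⟩⟩

/-- The `j`-dimensional Hausdorff measure on a translate of a `j`-dimensional subspace is the
Lebesgue measure of that subspace. -/
theorem euclideanHausdorffMeasure_eq_volume_preimage {j : ℕ} {V : Submodule ℝ (E d)}
    (hj : finrank ℝ V = j) {x : E d} {S : Set (E d)} (hS : ∀ y ∈ S, y - x ∈ V) :
    Measure.euclideanHausdorffMeasure j S = volume ((fun v : V => x + (v : E d)) ⁻¹' S) := by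
  rw [← InnerProductSpace.euclideanHausdorffMeasure_eq_volume, hj,
    (isometry_add_coe V x).euclideanHausdorffMeasure_preimage,
    Set.inter_eq_left.2 fun y hy => mem_range_add_coe.2 (hS y hy)]

end Hausdorff

namespace Polytope

variable {d : ℕ}

theorem inner_eq_zero_of_mem_normalCone {P F : Polytope d}
    (h : IsExposed ℝ P.carrier F.carrier) {u v : E d} (hu : u ∈ P.normalCone F)
    (hv : v ∈ vectorSpan ℝ F.carrier) : ⟪u, v⟫ = 0 := by
  have h1 : u ∈ (vectorSpan ℝ F.carrier)ᗮ := by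
    rw [← span_normalCone h]
    exact Submodule.subset_span hu
  exact (Submodule.mem_orthogonal' _ _).1 h1 v hv

theorem mem_carrier_of_mem_normalCone {P F : Polytope d} (h : IsExposed ℝ P.carrier F.carrier)
    {x v : E d} (hx : x ∈ F.carrier) (hv : v ∈ vectorSpan ℝ F.carrier) (hxv : x + v ∈ P.carrier) :
    x + v ∈ F.carrier := by
  refine (mem_carrier_iff_of_isExposed h).2 ⟨hxv, fun u hu y hy => ?_⟩
  rw [inner_add_right, inner_eq_zero_of_mem_normalCone h hu hv, add_zero]
  exact hu x hx y hy

/-- The normal cone of `F` is orthogonal to the directions of `F`, so by the local description `P`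
contains a neighbourhood, within the affine hull, of each point of the open face. Conversely, a
functional maximal over `P` at an interior point of `F` is constant along `F`. -/
theorem preimage_openFace {P F : Polytope d} (h : IsExposed ℝ P.carrier F.carrier) {x : E d}
    (hx : x ∈ F.carrier) :
    (fun v : vectorSpan ℝ F.carrier => x + (v : E d)) ⁻¹' P.openFace F =
      interior ((fun v : vectorSpan ℝ F.carrier => x + (v : E d)) ⁻¹' F.carrier) := by
  have hcont : Continuous fun v : vectorSpan ℝ F.carrier => x + (v : E d) := by fun_prop
  obtain ⟨U, hUo, hFU, hU⟩ := exists_isOpen_openFace_subset h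
  ext v
  constructor
  · intro hv
    rw [mem_interior]
    refine ⟨(fun v : vectorSpan ℝ F.carrier => x + (v : E d)) ⁻¹' U, fun w hw => ?_,
      hUo.preimage hcont, hFU hv⟩
    refine mem_carrier_of_mem_normalCone h hx w.2 ?_
    have h1 : x + (w : E d) ∈ {y | ∀ u ∈ P.normalCone F, ⟪u, y - x⟫ ≤ 0} ∩ U :=
      ⟨fun u hu => by rw [add_sub_cancel_left, inner_eq_zero_of_mem_normalCone h hu w.2], hw⟩
    rw [← hU x hx] at h1
    exact h1.1
  · intro hv
    have hvF : x + (v : E d) ∈ F.carrier := interior_subset (s := (fun v :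
      vectorSpan ℝ F.carrier => x + (v : E d)) ⁻¹' F.carrier) hv
    refine ⟨h.subset hvF, Set.Subset.antisymm (fun u hu => ?_) (normalCone_subset hvF)⟩
    have h0 : ∀ w ∈ vectorSpan ℝ F.carrier, ⟪u, w⟫ ≤ 0 := by
      intro w hw
      have hc : ContinuousAt (fun ε : ℝ => v + ε • (⟨w, hw⟩ : vectorSpan ℝ F.carrier)) 0 := by
        fun_prop
      have hev := hc.preimage_mem_nhds (t := (fun v : vectorSpan ℝ F.carrier => x + (v : E d)) ⁻¹'
        F.carrier) (by simpa using mem_interior_iff_mem_nhds.1 hv)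
      obtain ⟨ε, hε, hε0⟩ := Filter.nonempty_of_mem
        (Filter.inter_mem (nhdsWithin_le_nhds (s := Set.Ioi (0 : ℝ)) hev) self_mem_nhdsWithin)
      have hε0 : (0 : ℝ) < ε := hε0
      have h1 := hu _ (h.subset hε)
      simp only [Submodule.coe_add, Submodule.coe_smul, inner_add_right, inner_smul_right] at h1
      have h2 : ε * ⟪u, w⟫ ≤ 0 := by linarith
      exact nonpos_of_mul_nonpos_right h2 hε0
    intro z hz y hy
    have h1 := hu y hy
    have h2 := h0 _ (vsub_mem_vectorSpan ℝ hvF hz)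
    rw [vsub_eq_sub, inner_sub_right] at h2
    linarith

theorem measurableSet_openFace {P F : Polytope d} (h : IsExposed ℝ P.carrier F.carrier) :
    MeasurableSet (P.openFace F) := by
  obtain ⟨x, hx⟩ := F.nonempty
  have h1 := (isometry_add_coe (vectorSpan ℝ F.carrier) x).isClosedEmbedding.measurableEmbedding
  have h2 : P.openFace F = (fun v : vectorSpan ℝ F.carrier => x + (v : E d)) '' (interior
      ((fun v : vectorSpan ℝ F.carrier => x + (v : E d)) ⁻¹' F.carrier)) := by
    rw [← preimage_openFace h hx, Set.image_preimage_eq_inter_range, Set.left_eq_inter]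
    exact fun y hy => mem_range_add_coe.2 (vsub_mem_vectorSpan ℝ (openFace_subset h hy) hx)
  rw [h2]
  exact h1.measurableSet_image.2 isOpen_interior.measurableSet

theorem euclideanHausdorffMeasure_carrier_lt_top (F : Polytope d) :
    Measure.euclideanHausdorffMeasure F.dim F.carrier < ⊤ := by
  obtain ⟨x, hx⟩ := F.nonempty
  rw [euclideanHausdorffMeasure_eq_volume_preimage (j := F.dim) rfl
    fun y hy => vsub_mem_vectorSpan ℝ hy hx]
  exact ((isometry_add_coe _ x).isClosedEmbedding.isCompact_preimage F.isCompact).measure_lt_top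

theorem euclideanHausdorffMeasure_diff_openFace {P F : Polytope d}
    (h : IsExposed ℝ P.carrier F.carrier) :
    Measure.euclideanHausdorffMeasure F.dim (F.carrier \ P.openFace F) = 0 := by
  obtain ⟨x, hx⟩ := F.nonempty
  rw [euclideanHausdorffMeasure_eq_volume_preimage (j := F.dim) rfl
    fun y hy => vsub_mem_vectorSpan ℝ hy.1 hx, Set.preimage_sdiff, preimage_openFace h hx]
  -- In the coordinates of the affine hull, what remains lies in the frontier of a convex set, which
  -- is a null set.
  refine measure_mono_null (Set.sdiff_subset_sdiff_left subset_closure)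
    (Convex.addHaar_frontier _ ?_)
  have h1 := F.convex.translate_preimage_right x
  exact h1.linear_preimage (vectorSpan ℝ F.carrier).subtype

theorem euclideanHausdorffMeasure_openFace_pos {P F : Polytope d}
    (h : IsExposed ℝ P.carrier F.carrier) :
    0 < Measure.euclideanHausdorffMeasure F.dim (P.openFace F) := by
  obtain ⟨x, hx⟩ := openFace_nonempty h
  have hxF := openFace_subset h hx
  rw [euclideanHausdorffMeasure_eq_volume_preimage (j := F.dim) rfl
    fun y hy => vsub_mem_vectorSpan ℝ (openFace_subset h hy) hxF, preimage_openFace h hxF]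
  refine isOpen_interior.measure_pos _ ⟨0, ?_⟩
  rw [← preimage_openFace h hxF]
  simpa using hx

theorem isFiniteMeasure_faceMeasure {j : ℕ} {F : Polytope d} (hF : F.dim = j) :
    IsFiniteMeasure (faceMeasure j F) :=
  ⟨by rw [faceMeasure, Measure.restrict_apply_univ, ← hF]
      exact F.euclideanHausdorffMeasure_carrier_lt_top⟩

/-- The relative boundary is null, so `λ_F` can be computed on open faces, which, unlike faces, are
pairwise disjoint. -/
theorem faceMeasure_real_apply {j : ℕ} {P F : Polytope d} (hF : F ∈ faces j P) {A : Set (E d)}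
    (hA : MeasurableSet A) : (faceMeasure j F).real A =
      (Measure.euclideanHausdorffMeasure j).real (A ∩ P.openFace F) := by
  rw [faceMeasure, measureReal_restrict_apply hA, measureReal_def, measureReal_def]
  congr 1
  refine le_antisymm ?_ (measure_mono (Set.inter_subset_inter_right _ (openFace_subset hF.1)))
  rw [← Set.inter_union_sdiff (A ∩ F.carrier) (P.openFace F)]
  refine (measure_union_le _ _).trans ?_
  have h1 : Measure.euclideanHausdorffMeasure j ((A ∩ F.carrier) \ P.openFace F) = 0 := by
    refine measure_mono_null (Set.sdiff_subset_sdiff_left Set.inter_subset_right) ?_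
    rw [← hF.2]
    exact euclideanHausdorffMeasure_diff_openFace hF.1
  rw [h1, add_zero]
  exact measure_mono (Set.inter_subset_inter_left _ Set.inter_subset_left)

theorem faceMeasure_real_univ_pos {j : ℕ} {P F : Polytope d} (hF : F ∈ faces j P) :
    0 < (faceMeasure j F).real Set.univ := by
  rw [faceMeasure_real_apply hF MeasurableSet.univ, Set.univ_inter, measureReal_def,
    ENNReal.toReal_pos_iff, ← hF.2]
  exact ⟨euclideanHausdorffMeasure_openFace_pos hF.1, (measure_mono (openFace_subset hF.1)).trans_lt
    F.euclideanHausdorffMeasure_carrier_lt_top⟩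

theorem eq_of_subset_of_dim_le {P F G : Polytope d} (hF : IsExposed ℝ P.carrier F.carrier)
    (hG : IsExposed ℝ P.carrier G.carrier) (h : F.carrier ⊆ G.carrier) (hd : G.dim ≤ F.dim) :
    F = G := by
  refine Polytope.ext (h.antisymm fun y hy => ?_)
  obtain ⟨x, hx⟩ := F.nonempty
  have h1 : vectorSpan ℝ F.carrier = vectorSpan ℝ G.carrier :=
    Submodule.eq_of_le_of_finrank_le (vectorSpan_mono ℝ h) hd
  have h2 := mem_carrier_of_mem_normalCone hF hx (v := y - x)
    (h1 ▸ vsub_mem_vectorSpan ℝ hy (h hx)) (by simpa using hG.subset hy)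
  simpa using h2

theorem dim_le (P : Polytope d) : P.dim ≤ d :=
  (Submodule.finrank_le _).trans (finrank_euclideanSpace_fin).le

theorem dim_add_finrank_span_normalCone {P F : Polytope d} (h : IsExposed ℝ P.carrier F.carrier) :
    F.dim + finrank ℝ (Submodule.span ℝ (P.normalCone F)) = d := by
  rw [span_normalCone h, dim, Submodule.finrank_add_finrank_orthogonal, finrank_euclideanSpace_fin]

theorem vectorSpan_eq_of_normalCone_eq {P P' F F' : Polytope d}
    (h : IsExposed ℝ P.carrier F.carrier) (h' : IsExposed ℝ P'.carrier F'.carrier)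
    (hN : P.normalCone F = P'.normalCone F') :
    vectorSpan ℝ F.carrier = vectorSpan ℝ F'.carrier := by
  rw [← Submodule.orthogonal_orthogonal (vectorSpan ℝ F.carrier), ← span_normalCone h, hN,
    span_normalCone h', Submodule.orthogonal_orthogonal]

/-- A polytope has only itself as a face of full dimension. -/
theorem mem_faces_dim_iff {P F : Polytope d} : F ∈ faces P.dim P ↔ F = P := by
  refine ⟨fun h => eq_of_subset_of_dim_le h.1 (IsExposed.refl _) h.1.subset h.2.ge, ?_⟩
  rintro rfl
  exact ⟨IsExposed.refl _, rfl⟩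

end Polytope

/-! ### Averaging a measure over translations along a subspace. -/

section Fubini

variable {d : ℕ}

/-- Tonelli's theorem for the pairs `(a, v)` with `a ∈ A` and `a + w + v ∈ D`: for fixed `a` the
admissible `v` form a copy of `D` in `V`, whose volume does not depend on `a`. -/
theorem integral_measureReal_translate {j : ℕ} {V : Submodule ℝ (E d)} (hj : finrank ℝ V = j)
    (m : Measure (E d)) [IsFiniteMeasure m] {A D : Set (E d)} (hA : MeasurableSet A)
    (hD : MeasurableSet D) {w : E d} (hAD : ∀ a ∈ A, ∀ b ∈ D, b - (a + w) ∈ V)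
    (hD' : Measure.euclideanHausdorffMeasure j D ≠ ⊤) :
    Integrable (fun v : V => m.real {a | a ∈ A ∧ a + w + v ∈ D}) ∧
      ∫ v : V, m.real {a | a ∈ A ∧ a + w + v ∈ D} =
        (Measure.euclideanHausdorffMeasure j).real D * m.real A := by
  set H : Set (E d × V) := {p | p.1 ∈ A ∧ p.1 + w + p.2 ∈ D} with hH
  have hHm : MeasurableSet H :=
    (measurable_fst hA).inter ((by fun_prop : Measurable fun p : E d × V => p.1 + w + p.2) hD)
  have h1 : m.prod volume H = Measure.euclideanHausdorffMeasure j D * m A := by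
    rw [Measure.prod_apply hHm]
    have h2 : (fun a => volume (Prod.mk a ⁻¹' H : Set V)) =
        A.indicator fun _ => Measure.euclideanHausdorffMeasure j D := by
      ext a
      by_cases ha : a ∈ A
      · rw [Set.indicator_of_mem ha, euclideanHausdorffMeasure_eq_volume_preimage hj (hAD a ha)]
        congr 1
        ext v
        simp [hH, ha]
      · rw [Set.indicator_of_notMem ha]
        simp [hH, ha]
    rw [h2, lintegral_indicator_const hA]
  rw [Measure.prod_apply_symm hHm] at h1
  have h3 : ∫⁻ v : V, m {a | a ∈ A ∧ a + w + v ∈ D} =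
      Measure.euclideanHausdorffMeasure j D * m A := h1
  have h4 : Measurable fun v : V => m {a | a ∈ A ∧ a + w + v ∈ D} :=
    measurable_measure_prodMk_right hHm
  refine ⟨integrable_toReal_of_lintegral_ne_top h4.aemeasurable ?_, ?_⟩
  · rw [h3]
    exact ENNReal.mul_ne_top hD' (measure_ne_top _ _)
  · simp only [measureReal_def]
    rw [integral_toReal h4.aemeasurable (Filter.Eventually.of_forall fun _ => measure_lt_top _ _),
      h3, ENNReal.toReal_mul]

theorem integral_signedMeasure_translate {j : ℕ} {V : Submodule ℝ (E d)} (hj : finrank ℝ V = j)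
    (μ : SignedMeasure (E d)) {A D : Set (E d)} (hA : MeasurableSet A)
    (hD : MeasurableSet D) {w : E d} (hAD : ∀ a ∈ A, ∀ b ∈ D, b - (a + w) ∈ V)
    (hD' : Measure.euclideanHausdorffMeasure j D ≠ ⊤) :
    ∫ v : V, μ {a | a ∈ A ∧ a + w + v ∈ D} =
      (Measure.euclideanHausdorffMeasure j).real D * μ A := by
  have hμ : ∀ S, MeasurableSet S → μ S = μ.toJordanDecomposition.posPart.real S -
      μ.toJordanDecomposition.negPart.real S := fun S hS => by
    conv_lhs => rw [← μ.toSignedMeasure_toJordanDecomposition, JordanDecomposition.toSignedMeasure,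
      sub_apply, Measure.toSignedMeasure_apply_measurable hS,
      Measure.toSignedMeasure_apply_measurable hS]
  have hS : ∀ v : V, MeasurableSet {a | a ∈ A ∧ a + w + v ∈ D} := fun v =>
    hA.inter ((by fun_prop : Measurable fun a : E d => a + w + v) hD)
  obtain ⟨h1, h2⟩ := integral_measureReal_translate hj μ.toJordanDecomposition.posPart hA hD hAD hD'
  obtain ⟨h3, h4⟩ := integral_measureReal_translate hj μ.toJordanDecomposition.negPart hA hD hAD hD'
  simp_rw [fun v => hμ _ (hS v)]
  rw [integral_sub h1 h3, h2, h4, hμ A hA]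
  ring

end Fubini

/-! ### The local extension lives on the polytope and has constant density on each open face. -/

namespace IsLocalExtension

variable {d : ℕ} {φ : Polytope d → ℝ} {Φ : Polytope d → SignedMeasure (E d)}

/-- Infinitely many disjoint translates of `A` all have the mass of `A` under `Φ(P, ·)`, so
countable additivity forces this mass to be zero. Boundedness lets the translates avoid one another
and `P`. -/
theorem apply_eq_zero_of_disjoint_of_isBounded (hΦ : IsLocalExtension φ Φ) {P : Polytope d}
    {A : Set (E d)} (hA : MeasurableSet A) (hPA : Disjoint A P.carrier)
    (hb : Bornology.IsBounded A) : Φ P A = 0 := by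
  rcases subsingleton_or_nontrivial (E d) with hs | hn
  · have hP : P.carrier = Set.univ := Set.eq_univ_of_forall fun x => by
      obtain ⟨y, hy⟩ := P.nonempty
      rwa [Subsingleton.elim x y]
    rw [hP, Set.disjoint_univ] at hPA
    rw [hPA, VectorMeasure.empty]
  obtain ⟨e, he⟩ := exists_norm_eq (E d) zero_le_one
  obtain ⟨R, hR⟩ := (hb.union P.isCompact.isBounded).subset_closedBall 0
  have hR' : ∀ x ∈ A ∪ P.carrier, ‖x‖ ≤ |R| := fun x hx =>
    (mem_closedBall_zero_iff.1 (hR hx)).trans (le_abs_self R)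
  -- The spacing `2 * |R| + 1` exceeds the diameter of a ball that contains `A` and `P`.
  set x : ℕ → E d := fun n => ((2 * |R| + 1) * n) • e with hx
  have hfar : ∀ n m : ℕ, n ≠ m → ∀ a ∈ A ∪ P.carrier, ∀ b ∈ A ∪ P.carrier, a + x n ≠ b + x m := by
    intro n m hnm a ha b hb hab
    have h1 : ‖x n - x m‖ ≤ 2 * |R| := by
      have : x n - x m = b - a := by rw [sub_eq_sub_iff_add_eq_add, add_comm, hab]
      rw [this]
      exact (norm_sub_le _ _).trans (by linarith [hR' a ha, hR' b hb])
    have h2 : (1 : ℝ) ≤ |(n : ℝ) - m| := by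
      have : (1 : ℤ) ≤ |(n : ℤ) - m| := Int.one_le_abs (by omega)
      exact_mod_cast this
    have h3 : ‖x n - x m‖ = (2 * |R| + 1) * |(n : ℝ) - m| := by
      rw [hx, ← sub_smul, norm_smul, he, mul_one, ← mul_sub, Real.norm_eq_abs, abs_mul,
        abs_of_nonneg (by positivity)]
    nlinarith [abs_nonneg R]
  have hAm : ∀ n, MeasurableSet ((fun y => y + x n) '' A) := fun n =>
    (MeasurableEquiv.addRight (x n)).measurableSet_image.2 hA
  have hval : ∀ n, Φ P ((fun y => y + x n) '' A) = Φ P A := by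
    intro n
    rcases eq_or_ne n 0 with rfl | hn0
    · simp [hx]
    rw [← hΦ.translation_covariant P A (x n) hA]
    -- `P` and its translate both leave this open set empty, so locality identifies their values on
    -- the shifted `A`.
    refine hΦ.locally_determined _ _ _ (P.carrier ∪ (P.translate (x n)).carrier)ᶜ (hAm n)
      (P.isCompact.isClosed.union (P.translate (x n)).isCompact.isClosed).isOpen_compl ?_ ?_
    · rw [Set.compl_union, ← Set.inter_assoc, Set.inter_compl_self, Set.empty_inter,
        Set.inter_left_comm, Set.inter_compl_self, Set.inter_empty]
    · rintro _ ⟨a, ha, rfl⟩ (hP | hP)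
      · exact hfar n 0 hn0 a (Or.inl ha) _ (Or.inr hP) (by simp [hx])
      · obtain ⟨b, hb, hab⟩ := hP
        exact Set.disjoint_left.1 hPA ha (add_right_cancel hab ▸ hb)
  have hdis : Pairwise (Function.onFun Disjoint fun n => (fun y => y + x n) '' A) := by
    intro n m hnm
    refine Set.disjoint_left.2 ?_
    rintro _ ⟨a, ha, rfl⟩ ⟨b, hb, hab⟩
    exact hfar n m hnm a (Or.inl ha) b (Or.inl hb) hab.symm
  have hsum := ((Φ P).m_iUnion hAm hdis).summable
  simp_rw [hval] at hsum
  exact (summable_const_iff _).1 hsum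

/-- The local extension at `P` is concentrated on `P`. -/
theorem apply_eq_zero_of_disjoint (hΦ : IsLocalExtension φ Φ) {P : Polytope d}
    {A : Set (E d)} (hA : MeasurableSet A) (hPA : Disjoint A P.carrier) : Φ P A = 0 := by
  set B : ℕ → Set (E d) := fun n => Metric.closedBall 0 n with hB
  have hBm : ∀ n, MeasurableSet (A ∩ disjointed B n) := fun n =>
    hA.inter (MeasurableSet.disjointed (fun n => Metric.isClosed_closedBall.measurableSet) n)
  have hdis : Pairwise (Function.onFun Disjoint fun n => A ∩ disjointed B n) := fun n m hnm =>
    (disjoint_disjointed B hnm).mono Set.inter_subset_right Set.inter_subset_right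
  have hU : A = ⋃ n, A ∩ disjointed B n := by
    rw [← Set.inter_iUnion, iUnion_disjointed, hB, Metric.iUnion_closedBall_nat, Set.inter_univ]
  rw [hU, VectorMeasure.of_disjoint_iUnion hBm hdis]
  have h0 : ∀ n, Φ P (A ∩ disjointed B n) = 0 := fun n =>
    hΦ.apply_eq_zero_of_disjoint_of_isBounded (hBm n) (hPA.mono_left Set.inter_subset_left)
      (Metric.isBounded_closedBall.subset (Set.inter_subset_right.trans (disjointed_subset B n)))
  simp_rw [h0, tsum_zero]

/-- Where two polytopes have the same normal cone, the values of the local extension agree up to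
translation. -/
theorem apply_image_add (hΦ : IsLocalExtension φ Φ) {P P' F F' : Polytope d}
    (hF : IsExposed ℝ P.carrier F.carrier) (hF' : IsExposed ℝ P'.carrier F'.carrier)
    (hN : P.normalCone F = P'.normalCone F') {A : Set (E d)} (hA : MeasurableSet A)
    (hAF : A ⊆ P.openFace F) {w : E d} (hAF' : (fun y => y + w) '' A ⊆ P'.openFace F') :
    Φ P' ((fun y => y + w) '' A) = Φ P A := by
  rcases A.eq_empty_or_nonempty with rfl | ⟨a, ha⟩
  · simp
  obtain ⟨U, hUo, hFU, hU⟩ := Polytope.exists_isOpen_openFace_subset hF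
  obtain ⟨U', hUo', hFU', hU'⟩ := Polytope.exists_isOpen_openFace_subset hF'
  have h1 := hU a (Polytope.openFace_subset hF (hAF ha))
  have h2 := hU' (a + w) (Polytope.openFace_subset hF' (hAF' ⟨a, ha, rfl⟩))
  rw [← hΦ.translation_covariant P A w hA]
  refine hΦ.locally_determined _ _ _ (U' ∩ (fun y => y + w) '' U)
    ((MeasurableEquiv.addRight w).measurableSet_image.2 hA)
    (hUo'.inter ((Homeomorph.addRight w).isOpenMap _ hUo)) ?_
    (Set.subset_inter (hAF'.trans hFU') (Set.image_mono (hAF.trans hFU)))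
  ext y
  simp only [Polytope.carrier_translate, Set.mem_inter_iff, Set.image_add_right, Set.mem_preimage]
  -- Near the shifted set, `P + w` and `P'` are both the polar of the common normal cone, based at
  -- `a + w`.
  have e1 := Set.ext_iff.1 h1 (y + -w)
  have e2 := Set.ext_iff.1 h2 y
  simp only [Set.mem_inter_iff, Set.mem_ofPred_eq] at e1 e2
  rw [hN] at e1
  have h3 : y + -w - a = y - (a + w) := by abel
  rw [h3] at e1
  tauto

end IsLocalExtension

/-- The constant density of `Φ(P, ·)` with respect to the Lebesgue measure on the face `F`. -/
noncomputable def faceDensity {d : ℕ} (Φ : Polytope d → SignedMeasure (E d)) (P F : Polytope d) : ℝ :=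
  Φ P (P.openFace F) / (Polytope.faceMeasure F.dim F).real Set.univ

namespace IsLocalExtension

variable {d : ℕ} {φ : Polytope d → ℝ} {Φ : Polytope d → SignedMeasure (E d)}

/-- On the relative interior of a face, the local extension is a multiple of the Lebesgue measure,
and the factor depends only on the normal cone. -/
theorem apply_of_subset_openFace (hΦ : IsLocalExtension φ Φ) {P P' F F' : Polytope d}
    (hF : IsExposed ℝ P.carrier F.carrier) (hF' : IsExposed ℝ P'.carrier F'.carrier)
    (hN : P.normalCone F = P'.normalCone F') {A : Set (E d)} (hA : MeasurableSet A)
    (hAF : A ⊆ P.openFace F) :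
    Φ P A = faceDensity Φ P' F' * (Measure.euclideanHausdorffMeasure F.dim).real A := by
  have hV := Polytope.vectorSpan_eq_of_normalCone_eq hF hF' hN
  have hdim : F'.dim = F.dim := by rw [Polytope.dim, Polytope.dim, hV]
  set V := vectorSpan ℝ F.carrier with hVdef
  obtain ⟨x, hx⟩ := F.nonempty
  obtain ⟨x', hx'⟩ := F'.nonempty
  set w := x' - x with hw
  set D := P'.openFace F' with hDdef
  have hD : MeasurableSet D := Polytope.measurableSet_openFace hF'
  have hAD : ∀ a ∈ A, ∀ b ∈ D, b - (a + w) ∈ V := by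
    intro a ha b hb
    have h1 : a - x ∈ V := vsub_mem_vectorSpan ℝ (Polytope.openFace_subset hF (hAF ha)) hx
    have h2 : b - x' ∈ V := hV ▸ vsub_mem_vectorSpan ℝ (Polytope.openFace_subset hF' hb) hx'
    have h3 : b - (a + w) = (b - x') - (a - x) := by rw [hw]; abel
    rw [h3]
    exact V.sub_mem h2 h1
  have hDA : ∀ b ∈ D, ∀ a ∈ A, a - (b + -w) ∈ V := by
    intro b hb a ha
    have h1 : a - (b + -w) = -(b - (a + w)) := by abel
    rw [h1]
    exact V.neg_mem (hAD a ha b hb)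
  have hA' : Measure.euclideanHausdorffMeasure F.dim A ≠ ⊤ := ((measure_mono
    (hAF.trans (Polytope.openFace_subset hF))).trans_lt
      F.euclideanHausdorffMeasure_carrier_lt_top).ne
  have hD' : Measure.euclideanHausdorffMeasure F.dim D ≠ ⊤ := by
    rw [← hdim]
    exact ((measure_mono (Polytope.openFace_subset hF')).trans_lt
      F'.euclideanHausdorffMeasure_carrier_lt_top).ne
  -- The integrals of `Φ P` over `A ∩ (D - w - v)` and of `Φ P'` over its translate `(A + w + v) ∩
  -- D` agree by `apply_image_add`, after `v ↦ -v` in the second. Fubini evaluates them as `vol(D)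
  -- Φ(P, A)` and `vol(A) Φ(P', D)`, which gives proportionality and the common factor at once.
  have h1 := integral_signedMeasure_translate (j := F.dim) rfl (Φ P) hA hD hAD hD'
  have h2 := integral_signedMeasure_translate (j := F.dim) rfl (Φ P') hD hA hDA hA'
  rw [← integral_neg_eq_self] at h2
  have h3 : ∀ v : V, Φ P' {b | b ∈ D ∧ b + -w + ((-v : V) : E d) ∈ A} =
      Φ P {a | a ∈ A ∧ a + w + v ∈ D} := by
    intro v
    have h4 : {b | b ∈ D ∧ b + -w + ((-v : V) : E d) ∈ A} =
        (fun y => y + (w + v)) '' {a | a ∈ A ∧ a + w + v ∈ D} := by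
      ext b
      have : b + -w + ((-v : V) : E d) = b + -(w + v) := by rw [Submodule.coe_neg]; abel
      rw [Set.image_add_right]
      simp only [Set.mem_ofPred_eq, Set.mem_preimage, this]
      rw [add_assoc (b + _), neg_add_cancel_right]
      tauto
    rw [h4]
    refine hΦ.apply_image_add hF hF' hN
      (hA.inter ((by fun_prop : Measurable fun a : E d => a + w + v) hD)) (fun a ha => hAF ha.1) ?_
    rintro _ ⟨a, ha, rfl⟩
    simp only [← add_assoc]
    exact ha.2
  simp_rw [h3] at h2
  rw [h1] at h2
  have h5 : (Polytope.faceMeasure F'.dim F').real Set.univ =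
      (Measure.euclideanHausdorffMeasure F.dim).real D := by
    rw [Polytope.faceMeasure_real_apply ⟨hF', rfl⟩ MeasurableSet.univ, Set.univ_inter, hdim]
  have h6 := Polytope.faceMeasure_real_univ_pos (P := P') (F := F') ⟨hF', rfl⟩
  rw [faceDensity, div_mul_eq_mul_div, eq_div_iff h6.ne', h5, mul_comm, h2, mul_comm]

/-- This makes the density a function of the normal cone alone, which is what allows `f_j` to be
defined. -/
theorem faceDensity_eq (hΦ : IsLocalExtension φ Φ) {P P' F F' : Polytope d}
    (hF : IsExposed ℝ P.carrier F.carrier) (hF' : IsExposed ℝ P'.carrier F'.carrier)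
    (hN : P.normalCone F = P'.normalCone F') : faceDensity Φ P F = faceDensity Φ P' F' := by
  have h1 := hΦ.apply_of_subset_openFace hF hF' hN (Polytope.measurableSet_openFace hF) subset_rfl
  have h6 := Polytope.faceMeasure_real_univ_pos (P := P) (F := F) ⟨hF, rfl⟩
  rw [faceDensity, h1, Polytope.faceMeasure_real_apply (P := P) ⟨hF, rfl⟩ MeasurableSet.univ,
    Set.univ_inter, mul_div_assoc, div_self, mul_one]
  rw [Polytope.faceMeasure_real_apply (P := P) ⟨hF, rfl⟩ MeasurableSet.univ, Set.univ_inter] at h6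
  exact h6.ne'

end IsLocalExtension

/-- The part of `Φ(P, A)` that comes from the `j`-dimensional faces of `P`. -/
noncomputable def faceSum {d : ℕ} (Φ : Polytope d → SignedMeasure (E d)) (j : ℕ) (P : Polytope d)
    (A : Set (E d)) : ℝ :=
  ∑ F : Polytope.faces j P, faceDensity Φ P F.1 * (Polytope.faceMeasure j F.1).real A

namespace IsLocalExtension

variable {d : ℕ} {φ : Polytope d → ℝ} {Φ : Polytope d → SignedMeasure (E d)}

theorem apply_eq_sum_faceSum (hΦ : IsLocalExtension φ Φ) (P : Polytope d) {A : Set (E d)}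
    (hA : MeasurableSet A) : Φ P A = ∑ j : Fin (d + 1), faceSum Φ j P A := by
  let ι := Σ j : Fin (d + 1), Polytope.faces (j : ℕ) P
  have hm : ∀ i : ι, MeasurableSet (A ∩ P.openFace i.2.1) := fun i =>
    hA.inter (Polytope.measurableSet_openFace i.2.2.1)
  have hdis : Pairwise (Function.onFun Disjoint fun i : ι => A ∩ P.openFace i.2.1) := by
    rintro ⟨i, F⟩ ⟨j, G⟩ hne
    refine (Polytope.pairwise_disjoint_openFace F.2.1 G.2.1 fun h => hne ?_).mono
      Set.inter_subset_right Set.inter_subset_right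
    have hij : i = j := Fin.ext (F.2.2.symm.trans ((congrArg Polytope.dim h).trans G.2.2))
    subst hij
    rw [Subtype.ext h]
  have hU : A ∩ P.carrier = ⋃ i : ι, A ∩ P.openFace i.2.1 := by
    rw [← Set.inter_iUnion]
    congr 1
    refine Set.Subset.antisymm (fun x hx => ?_) (Set.iUnion_subset fun i x hx => hx.1)
    obtain ⟨F, hF, hxF⟩ := P.exists_mem_openFace hx
    exact Set.mem_iUnion.2 ⟨⟨⟨F.dim, Nat.lt_succ_of_le F.dim_le⟩, ⟨F, hF, rfl⟩⟩, hxF⟩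
  have h1 : Φ P A = Φ P (A ∩ P.carrier) := by
    conv_lhs => rw [← Set.inter_union_sdiff A P.carrier]
    rw [VectorMeasure.of_union (Set.disjoint_sdiff_right.mono_left Set.inter_subset_right)
      (hA.inter P.measurableSet) (hA.diff P.measurableSet),
      hΦ.apply_eq_zero_of_disjoint (hA.diff P.measurableSet) Set.disjoint_sdiff_left, add_zero]
  rw [h1, hU, VectorMeasure.of_disjoint_iUnion hm hdis, tsum_fintype, Fintype.sum_sigma]
  refine Finset.sum_congr rfl fun j _ => Finset.sum_congr rfl fun F _ => ?_
  rw [hΦ.apply_of_subset_openFace F.2.1 F.2.1 rfl (hA.inter (Polytope.measurableSet_openFace F.2.1))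
    Set.inter_subset_right, Polytope.faceMeasure_real_apply F.2 hA, F.2.2]

end IsLocalExtension

/-! ### Polyhedral cones and their polars. -/

section PolyhedralCone

variable {d : ℕ}

theorem IsPolyhedralCone.smul_mem {C : Set (E d)} (hC : IsPolyhedralCone C) {r : ℝ} (hr : 0 ≤ r)
    {u : E d} (hu : u ∈ C) : r • u ∈ C := by
  obtain ⟨s, rfl⟩ := hC
  intro a ha
  rw [inner_smul_right]
  exact mul_nonpos_of_nonneg_of_nonpos hr (hu a ha)

theorem IsPolyhedralCone.zero_mem {C : Set (E d)} (hC : IsPolyhedralCone C) : (0 : E d) ∈ C := by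
  obtain ⟨s, rfl⟩ := hC
  intro a _
  rw [inner_zero_right]

theorem IsPolyhedralCone.add_mem {C : Set (E d)} (hC : IsPolyhedralCone C) {u v : E d}
    (hu : u ∈ C) (hv : v ∈ C) : u + v ∈ C := by
  obtain ⟨s, rfl⟩ := hC
  intro a ha
  rw [inner_add_right]
  exact add_nonpos (hu a ha) (hv a ha)

theorem IsPolyhedralCone.isClosed {C : Set (E d)} (hC : IsPolyhedralCone C) : IsClosed C := by
  obtain ⟨s, rfl⟩ := hC
  simp only [Set.ofPred_forall]
  exact isClosed_biInter fun q _ => isClosed_le (by fun_prop) (by fun_prop)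

theorem IsPolyhedralCone.convex {C : Set (E d)} (hC : IsPolyhedralCone C) : Convex ℝ C :=
  fun _ hu _ hv _ _ ha hb _ => hC.add_mem (hC.smul_mem ha hu) (hC.smul_mem hb hv)

/-- A non-zero element of a cone is a multiple of a unit vector of the cone. -/
theorem IsPolyhedralCone.exists_eq_norm_smul {C : Set (E d)} (hC : IsPolyhedralCone C) {u : E d}
    (hu : u ∈ C) (hu0 : u ≠ 0) : ∃ v ∈ C ∩ Metric.sphere 0 1, u = ‖u‖ • v := by
  have h0 : ‖u‖ ≠ 0 := norm_ne_zero_iff.2 hu0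
  refine ⟨‖u‖⁻¹ • u, ⟨hC.smul_mem (by positivity) hu, ?_⟩, ?_⟩
  · rw [mem_sphere_zero_iff_norm, norm_smul, norm_inv, norm_norm, inv_mul_cancel₀ h0]
  · rw [smul_smul, mul_inv_cancel₀ h0, one_smul]

theorem IsPolyhedralCone.inner_nonpos {C : Set (E d)} (hC : IsPolyhedralCone C) {x : E d}
    (hx : ∀ u ∈ C ∩ Metric.sphere 0 1, ⟪u, x⟫ ≤ 0) {u : E d} (hu : u ∈ C) : ⟪u, x⟫ ≤ 0 := by
  by_cases hu0 : u = 0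
  · rw [hu0, inner_zero_left]
  · obtain ⟨v, hv, h⟩ := hC.exists_eq_norm_smul hu hu0
    rw [h, real_inner_smul_left]
    exact mul_nonpos_of_nonneg_of_nonpos (norm_nonneg _) (hx v hv)

/-- The polar of a polyhedral cone is polyhedral. -/
theorem IsPolyhedralCone.exists_polar_eq {C : Set (E d)} (hC : IsPolyhedralCone C) :
    ∃ I : Finset (E d × ℝ), {x | ∀ u ∈ C ∩ Metric.sphere 0 1, ⟪u, x⟫ ≤ 0} =
      {x | ∀ q ∈ I, ⟪q.1, x⟫ ≤ q.2} := by
  classical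
  have hC' := hC
  obtain ⟨s, hs⟩ := hC'
  -- The cube contains all unit vectors, so the finite set spanning `C ∩ unitCube d` suffices to
  -- test membership in the polar.
  obtain ⟨t, ht⟩ := exists_eq_convexHull_inter_unitCube (s.image fun a => (a, (0 : ℝ)))
  have hCt : C ∩ unitCube d = convexHull ℝ (t : Set (E d)) := by
    rw [← ht, hs]
    simp
  refine ⟨t.image fun u => (u, 0), ?_⟩
  ext x
  simp only [Finset.mem_image, Set.mem_ofPred_eq, forall_exists_index, and_imp,
    forall_apply_eq_imp_iff₂]
  constructor
  · intro h u hu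
    have h1 : u ∈ C ∩ unitCube d := hCt ▸ subset_convexHull ℝ _ hu
    exact hC.inner_nonpos h h1.1
  · intro h u hu
    have h1 : u ∈ convexHull ℝ (t : Set (E d)) := hCt ▸ ⟨hu.1, sphere_subset_unitCube d hu.2⟩
    have h2 : convexHull ℝ (t : Set (E d)) ⊆ {u | ⟪u, x⟫ ≤ 0} := by
      refine convexHull_min h ?_
      simp_rw [real_inner_comm x]
      exact convex_halfSpace_le (innerSL ℝ x).isLinear 0
    exact h2 h1

end PolyhedralCone

/-! ### Every spherical polytope as the normal image of a face. -/

namespace SphericalPolytope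

variable {d m : ℕ}

/-- The polytope that coincides in the unit cube with the polar of the cone spanned by a spherical
polytope. -/
def polarPolytope (p : SphericalPolytope d m) : Polytope d :=
  ⟨⟨⟨{x | ∀ u ∈ (p.1 : Set (E d)), ⟪u, x⟫ ≤ 0} ∩ unitCube d, by
      refine (isCompact_unitCube d).inter_left ?_
      simp only [Set.ofPred_forall]
      exact isClosed_biInter fun q _ => isClosed_le (by fun_prop) (by fun_prop)⟩,
    ⟨0, fun u _ => (inner_zero_right u).le, fun i => by simp⟩⟩, by
    obtain ⟨C, hC, -, hp⟩ := p.2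
    obtain ⟨I, hI⟩ := hC.exists_polar_eq
    obtain ⟨t, ht⟩ := exists_eq_convexHull_inter_unitCube I
    refine ⟨t, ?_⟩
    rw [← ht, ← hI, ← hp]
    rfl⟩

theorem zero_mem_polarPolytope (p : SphericalPolytope d m) :
    (0 : E d) ∈ (polarPolytope p).carrier :=
  ⟨fun u _ => (inner_zero_right u).le, fun i => by simp⟩

/-- The smallest face of the polar polytope that contains the origin. -/
noncomputable def polarFace (p : SphericalPolytope d m) : Polytope d :=
  ((polarPolytope p).exists_mem_openFace (zero_mem_polarPolytope p)).choose

theorem isExposed_polarFace (p : SphericalPolytope d m) :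
    IsExposed ℝ (polarPolytope p).carrier (polarFace p).carrier :=
  ((polarPolytope p).exists_mem_openFace (zero_mem_polarPolytope p)).choose_spec.1

theorem zero_mem_openFace_polarFace (p : SphericalPolytope d m) :
    (0 : E d) ∈ (polarPolytope p).openFace (polarFace p) :=
  ((polarPolytope p).exists_mem_openFace (zero_mem_polarPolytope p)).choose_spec.2

theorem zero_mem_polarFace (p : SphericalPolytope d m) : (0 : E d) ∈ (polarFace p).carrier :=
  Polytope.openFace_subset (isExposed_polarFace p) (zero_mem_openFace_polarFace p)

/-- The cube is not felt near the origin, so the normal cone there is the bipolar of `C`. It equals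
`C` because the vectors defining `C`, suitably shortened, belong to the polar polytope. -/
theorem normalCone_polarFace {p : SphericalPolytope d m} {C : Set (E d)} (hC : IsPolyhedralCone C)
    (hp : (p.1 : Set (E d)) = C ∩ Metric.sphere 0 1) :
    (polarPolytope p).normalCone (polarFace p) = C := by
  rw [← (zero_mem_openFace_polarFace p).2]
  refine Set.Subset.antisymm ?_ ?_
  · have hC' := hC
    obtain ⟨s, hs⟩ := hC'
    intro u hu
    rw [hs]
    intro a ha
    have h1 : (‖a‖ + 1)⁻¹ • a ∈ (polarPolytope p).carrier := by
      refine ⟨fun v hv => ?_, closedBall_subset_unitCube d le_rfl ?_⟩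
      · rw [hp, hs] at hv
        rw [inner_smul_right, real_inner_comm]
        exact mul_nonpos_of_nonneg_of_nonpos (by positivity) (hv.1 a ha)
      · rw [mem_closedBall_zero_iff, norm_smul, norm_inv, Real.norm_of_nonneg (by positivity),
          inv_mul_le_one₀ (by positivity)]
        linarith
    have h2 := hu _ h1
    rw [inner_zero_right, inner_smul_right, real_inner_comm] at h2
    exact nonpos_of_mul_nonpos_right h2 (by positivity)
  · intro u hu y hy
    rw [inner_zero_right]
    exact hC.inner_nonpos (fun v hv => hy.1 v (hp ▸ hv)) hu

theorem polarFace_mem_faces {j : Fin d} (p : SphericalPolytope d (d - 1 - j)) :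
    polarFace p ∈ Polytope.faces (j : ℕ) (polarPolytope p) := by
  refine ⟨isExposed_polarFace p, ?_⟩
  obtain ⟨C, hC, hdim, hp⟩ := p.2
  have h1 := Polytope.dim_add_finrank_span_normalCone (isExposed_polarFace p)
  rw [normalCone_polarFace hC hp, hdim] at h1
  have := j.2
  omega

theorem normalImage_polarFace {j : Fin d} (p : SphericalPolytope d (d - 1 - j)) :
    (polarPolytope p).normalImage ⟨polarFace p, polarFace_mem_faces p⟩ = p := by
  obtain ⟨C, hC, -, hp⟩ := p.2
  apply Subtype.ext
  apply SetLike.coe_injective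
  rw [hp, ← normalCone_polarFace hC hp]
  rfl

/-- The only face of the polar polytope that meets the ball of radius `1/2` and has the dimension of
the smallest face at the origin is that face itself. -/
theorem eq_polarFace {p : SphericalPolytope d m} {F : Polytope d}
    (hF : IsExposed ℝ (polarPolytope p).carrier F.carrier) (hdim : F.dim ≤ (polarFace p).dim)
    {y : E d} (hy : y ∈ F.carrier) (hyb : y ∈ Metric.closedBall (0 : E d) (1 / 2)) :
    F = polarFace p := by
  have hyP := hF.subset hy
  have h2y : (2 : ℝ) • y ∈ (polarPolytope p).carrier := by
    refine ⟨fun u hu => ?_, closedBall_subset_unitCube d le_rfl ?_⟩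
    · rw [inner_smul_right]
      linarith [hyP.1 u hu]
    · rw [mem_closedBall_zero_iff] at hyb ⊢
      rw [norm_smul, Real.norm_two]
      linarith
  -- The point `y` is the midpoint of `0` and `2 • y`, both in the polytope thanks to the radius `1
  -- / 2`. Hence a functional maximal at `y` vanishes there and is also maximal at `0`.
  have hN : (polarPolytope p).normalCone F ⊆ (polarPolytope p).normalConeAt 0 := by
    intro u hu z hz
    have h1 := hu y hy _ h2y
    have h2 := hu y hy _ (zero_mem_polarPolytope p)
    have h3 := hu y hy z hz
    rw [inner_smul_right] at h1
    rw [inner_zero_right] at h2 ⊢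
    linarith
  refine (Polytope.eq_of_subset_of_dim_le (isExposed_polarFace p) hF (fun z hz => ?_) hdim).symm
  rw [Polytope.mem_carrier_iff_of_isExposed (isExposed_polarFace p)] at hz
  rw [(zero_mem_openFace_polarFace p).2] at hN
  exact (Polytope.mem_carrier_iff_of_isExposed hF).2 ⟨hz.1, hN.trans hz.2⟩

/-- Inside the ball the face fills its whole linear span, since that span is orthogonal to the cone
and the cube is inactive. The value is therefore independent of `p`. -/
theorem faceMeasure_polarFace_closedBall {j : ℕ} {p : SphericalPolytope d m}
    (hj : (polarFace p).dim = j) :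
    (Polytope.faceMeasure j (polarFace p)).real (Metric.closedBall 0 (1 / 2)) =
      volume.real (Metric.closedBall (0 : E j) (1 / 2)) := by
  set V := vectorSpan ℝ (polarFace p).carrier with hV
  have hrank : finrank ℝ V = j := hj
  have hb : Metric.closedBall 0 (1 / 2) ∩ (polarFace p).carrier =
      {v : E d | v ∈ V ∧ v ∈ Metric.closedBall 0 (1 / 2)} := by
    ext v
    refine ⟨fun h => ⟨?_, h.1⟩, fun h => ⟨h.2, ?_⟩⟩
    · simpa using vsub_mem_vectorSpan ℝ h.2 (zero_mem_polarFace p)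
    · have h1 := Polytope.mem_carrier_of_mem_normalCone (isExposed_polarFace p)
        (zero_mem_polarFace p) h.1 ?_
      · simpa using h1
      · rw [zero_add]
        refine ⟨fun u hu => ?_, closedBall_subset_unitCube d (by norm_num) h.2⟩
        obtain ⟨C, hC, -, hp⟩ := p.2
        rw [Polytope.inner_eq_zero_of_mem_normalCone (isExposed_polarFace p)
          (by rw [normalCone_polarFace hC hp]; exact (hp ▸ hu : u ∈ C ∩ Metric.sphere 0 1).1) h.1]
  rw [Polytope.faceMeasure, measureReal_restrict_apply Metric.isClosed_closedBall.measurableSet, hb,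
    measureReal_def, measureReal_def,
    euclideanHausdorffMeasure_eq_volume_preimage hrank (x := 0) (fun y hy => by simpa using hy.1)]
  congr 1
  let e : E j ≃ₗᵢ[ℝ] V := ((stdOrthonormalBasis ℝ V).reindex (finCongr hrank)).repr.symm
  rw [← e.measurePreserving.measure_preimage_emb e.toHomeomorph.measurableEmbedding]
  congr 1
  ext v
  simp only [Set.mem_preimage, Set.mem_ofPred_eq, mem_closedBall_zero_iff, zero_add,
    SetLike.coe_mem, true_and]
  rw [← Submodule.coe_norm, e.norm_map]

/-- Evaluating a sum over the `j`-faces of a polar polytope near the origin singles out one value. -/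
theorem sum_faces_polarPolytope {j : Fin d} (g : SphericalPolytope d (d - 1 - j) → ℝ)
    (p : SphericalPolytope d (d - 1 - j)) :
    ∑ F : Polytope.faces (j : ℕ) (polarPolytope p), g ((polarPolytope p).normalImage F) *
      (Polytope.faceMeasure (j : ℕ) F.1).real (Metric.closedBall 0 (1 / 2)) =
        g p * volume.real (Metric.closedBall (0 : E j) (1 / 2)) := by
  rw [Finset.sum_eq_single ⟨polarFace p, polarFace_mem_faces p⟩, normalImage_polarFace,
    faceMeasure_polarFace_closedBall (polarFace_mem_faces p).2]
  · intro F _ hF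
    have h1 : Metric.closedBall (0 : E d) (1 / 2) ∩ F.1.carrier = ∅ := by
      refine Set.eq_empty_of_forall_notMem fun y hy => hF (Subtype.ext ?_)
      exact eq_polarFace F.2.1 (F.2.2.trans (polarFace_mem_faces p).2.symm).le hy.2 hy.1
    rw [Polytope.faceMeasure, measureReal_restrict_apply Metric.isClosed_closedBall.measurableSet,
      h1, measureReal_empty, mul_zero]
  · exact fun h => absurd (Finset.mem_univ _) h

theorem volume_real_closedBall_pos (j : ℕ) :
    0 < volume.real (Metric.closedBall (0 : E j) (1 / 2)) :=
  ENNReal.toReal_pos (Metric.measure_closedBall_pos _ _ (by norm_num)).ne' measure_closedBall_lt_top.ne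

/-- Project `x` onto the cone `C` of `q`, with image `z`. Then `x - z` is in the polar of `C`, and
`‖z‖ ≤ ε * K` because unit vectors of `C` are `ε`-close to `p`, on which `x` is non-positive. -/
theorem exists_dist_polarPolytope_le {K : ℝ} (hK : ∀ x ∈ unitCube d, ‖x‖ ≤ K)
    (p q : SphericalPolytope d m) {x : E d} (hx : x ∈ (polarPolytope p).carrier) :
    ∃ y ∈ (polarPolytope q).carrier, dist x y ≤ (K + K * K) * dist p q := by
  obtain ⟨C, hC, -, hq⟩ := q.2
  set ε := dist p q with hε
  have hε0 : 0 ≤ ε := dist_nonneg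
  have hxK := hK x hx.2
  have hK0 : 0 ≤ K := (norm_nonneg x).trans hxK
  have hnear : ∀ v ∈ (q.1 : Set (E d)), ⟪v, x⟫ ≤ ε * K := by
    intro v hv
    obtain ⟨u, hu, huv⟩ := p.1.isCompact.exists_infDist_eq_dist p.1.nonempty v
    have h1 : Metric.infDist v (p.1 : Set (E d)) ≤ ε := by
      rw [hε, dist_comm]
      exact Metric.infDist_le_hausdorffDist_of_mem hv (edist_ne_top q.1 p.1)
    rw [huv, dist_eq_norm] at h1
    have h2 := real_inner_le_norm (v - u) x
    rw [inner_sub_left] at h2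
    nlinarith [hx.1 u hu, mul_le_mul h1 hxK (norm_nonneg _) hε0]
  obtain ⟨z, hz, hmin⟩ := exists_norm_eq_iInf_of_complete_convex ⟨0, hC.zero_mem⟩
    hC.isClosed.isComplete hC.convex x
  rw [norm_eq_iInf_iff_real_inner_le_zero hC.convex hz] at hmin
  have hpol : ∀ w ∈ C, ⟪w, x - z⟫ ≤ 0 := by
    intro w hw
    have := hmin _ (hC.add_mem hz hw)
    rwa [add_sub_cancel_left, real_inner_comm] at this
  have horth : ⟪z, x⟫ = ‖z‖ * ‖z‖ := by
    have h1 := hpol z hz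
    have h2 := hmin 0 hC.zero_mem
    rw [zero_sub, inner_neg_right, real_inner_comm] at h2
    rw [inner_sub_right] at h1 h2
    rw [← real_inner_self_eq_norm_mul_norm]
    linarith
  have hzn : ‖z‖ ≤ ε * K := by
    by_cases hz0 : z = 0
    · rw [hz0, norm_zero]
      positivity
    · obtain ⟨v, hv, hzv⟩ := hC.exists_eq_norm_smul hz hz0
      have h1 := hnear v (hq ▸ hv)
      rw [hzv, real_inner_smul_left, ← hzv] at horth
      rw [← mul_left_cancel₀ (norm_ne_zero_iff.2 hz0) horth]
      exact h1
  have hc : 0 < 1 + ε * K := by positivity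
  -- Subtracting `z` may leave the cube by at most `ε * K` in each coordinate; the factor brings the
  -- point back and costs the term `K * K` in the constant.
  set y := (1 + ε * K)⁻¹ • (x - z) with hy
  have hyq : y ∈ (polarPolytope q).carrier := by
    refine ⟨fun u hu => ?_, fun i => ?_⟩
    · rw [hy, inner_smul_right]
      exact mul_nonpos_of_nonneg_of_nonpos (by positivity)
        (hpol u (hq ▸ hu : u ∈ C ∩ Metric.sphere 0 1).1)
    · have h1 : |x i| ≤ 1 := hx.2 i
      have h2 : |z i| ≤ ‖z‖ := PiLp.norm_apply_le z i
      have h3 : |x i - z i| ≤ |x i| + |z i| := abs_sub _ _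
      rw [hy, PiLp.smul_apply, PiLp.sub_apply, smul_eq_mul, abs_mul, abs_inv, abs_of_pos hc,
        inv_mul_le_one₀ hc]
      linarith
  refine ⟨y, hyq, ?_⟩
  have hxy : x - y = z + (ε * K) • y := by
    have h1 : (1 + ε * K) • y = x - z := by rw [hy, smul_smul, mul_inv_cancel₀ hc.ne', one_smul]
    rw [add_smul, one_smul] at h1
    rw [eq_sub_iff_add_eq] at h1
    rw [← h1]
    abel
  have hyK := hK y hyq.2
  rw [dist_eq_norm, hxy]
  refine (norm_add_le _ _).trans ?_
  rw [norm_smul, Real.norm_of_nonneg (by positivity)]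
  nlinarith [mul_le_mul_of_nonneg_left hyK (by positivity : 0 ≤ ε * K)]

/-- Continuity here carries the measurability of `P ↦ Φ(P, A)` over to the functions `f_j`. -/
theorem continuous_polarPolytope :
    Continuous (polarPolytope : SphericalPolytope d m → Polytope d) := by
  obtain ⟨K, hK⟩ := (isCompact_unitCube d).isBounded.exists_norm_le
  have hK0 : 0 ≤ K := (norm_nonneg (0 : E d)).trans (hK 0 fun i => by simp)
  refine (LipschitzWith.of_dist_le_mul (K := ⟨K + K * K, by positivity⟩) fun p q => ?_).continuous
  refine Metric.hausdorffDist_le_of_mem_dist (mul_nonneg (NNReal.coe_nonneg _) dist_nonneg)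
    (fun x hx => exists_dist_polarPolytope_le hK p q hx) (fun x hx => ?_)
  obtain ⟨y, hy, h⟩ := exists_dist_polarPolytope_le hK q p hx
  exact ⟨y, hy, dist_comm p q ▸ h⟩

end SphericalPolytope

/-! ### Comparison of polynomial coefficients. -/

/-- The coefficients of a polynomial of degree less than `n` are linear combinations of its values
at `1, …, n`. -/
theorem exists_coeff_eq_sum_eval (n : ℕ) : ∃ c : Fin n → Fin n → ℝ, ∀ (a : Fin n → ℝ) (j : Fin n),
    a j = ∑ k : Fin n, c j k * ∑ i : Fin n, ((k : ℝ) + 1) ^ (i : ℕ) * a i := by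
  -- The nodes are `k + 1`, not `k`, so that all of them can serve as dilation factors.
  let M : Matrix (Fin n) (Fin n) ℝ := Matrix.vandermonde fun k => (k : ℝ) + 1
  have hM : IsUnit M.det := by
    rw [isUnit_iff_ne_zero, Matrix.det_vandermonde_ne_zero_iff]
    intro k l h
    simpa [Fin.ext_iff] using h
  refine ⟨fun j k => M⁻¹ j k, fun a j => ?_⟩
  have h1 : M⁻¹.mulVec (M.mulVec a) = a := by
    rw [Matrix.mulVec_mulVec, Matrix.nonsing_inv_mul _ hM, Matrix.one_mulVec]
  have h2 := (congrFun h1 j).symm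
  simp only [Matrix.mulVec, dotProduct] at h2
  exact h2

theorem eq_of_forall_pos_sum_pow_eq {n : ℕ} {a b : Fin n → ℝ} (h : ∀ α : ℝ, 0 < α →
    ∑ i : Fin n, α ^ (i : ℕ) * a i = ∑ i : Fin n, α ^ (i : ℕ) * b i) : a = b := by
  obtain ⟨c, hc⟩ := exists_coeff_eq_sum_eval n
  funext j
  rw [hc a j, hc b j]
  exact Finset.sum_congr rfl fun k _ => by rw [h _ (by positivity)]

theorem eq_and_eq_of_forall_pos_sum_pow_eq {d : ℕ} {a b : Fin d → ℝ} {a' b' : ℝ}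
    (h : ∀ α : ℝ, 0 < α → ∑ i : Fin d, α ^ (i : ℕ) * a i + α ^ d * a' =
      ∑ i : Fin d, α ^ (i : ℕ) * b i + α ^ d * b') : a = b ∧ a' = b' := by
  have h1 : (Fin.snoc a a' : Fin (d + 1) → ℝ) = Fin.snoc b b' :=
    eq_of_forall_pos_sum_pow_eq fun α hα => by
      simpa [Fin.sum_univ_castSucc] using h α hα
  refine ⟨funext fun j => ?_, ?_⟩
  · simpa using congrFun h1 j.castSucc
  · simpa using congrFun h1 (Fin.last d)

/-! ### Dilation of faces, intrinsic volume in top dimension, and the cube. -/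

namespace Polytope

variable {d : ℕ}

theorem mem_dilate {α : ℝ} (hα : 0 < α) {P : Polytope d} {x : E d} :
    x ∈ (P.dilate α).carrier ↔ α⁻¹ • x ∈ P.carrier := by
  rw [carrier_dilate, Set.mem_smul_set_iff_inv_smul_mem₀ hα.ne']

theorem smul_mem_dilate {α : ℝ} {P : Polytope d} {x : E d} (hx : x ∈ P.carrier) :
    α • x ∈ (P.dilate α).carrier := by
  rw [carrier_dilate]
  exact Set.smul_mem_smul_set hx

theorem dilate_dilate (α β : ℝ) (P : Polytope d) :
    (P.dilate α).dilate β = P.dilate (β * α) := by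
  apply Polytope.ext
  rw [carrier_dilate, carrier_dilate, carrier_dilate, mul_smul]

theorem dilate_one (P : Polytope d) : P.dilate 1 = P := by
  apply Polytope.ext
  rw [carrier_dilate, one_smul]

theorem translate_dilate (α : ℝ) (P : Polytope d) (x : E d) :
    (P.translate x).dilate α = (P.dilate α).translate (α • x) := by
  apply Polytope.ext
  rw [carrier_dilate, carrier_translate, carrier_translate, carrier_dilate,
    ← Set.image_smul, ← Set.image_smul, Set.image_image, Set.image_image]
  simp only [smul_add]

theorem continuous_dilate (α : ℝ) : Continuous fun P : Polytope d => P.dilate α :=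
  ((ContinuousAffineMap.continuous (α • ContinuousAffineMap.id ℝ (E d))).nonemptyCompacts_map.comp
    continuous_subtype_val).subtype_mk _

theorem normalCone_dilate {α : ℝ} (hα : 0 < α) (P F : Polytope d) :
    (P.dilate α).normalCone (F.dilate α) = P.normalCone F := by
  ext u
  constructor
  · intro hu x hx y hy
    have h1 := hu _ (smul_mem_dilate hx) _ (smul_mem_dilate hy)
    rw [inner_smul_right, inner_smul_right] at h1
    exact le_of_mul_le_mul_left h1 hα
  · intro hu x hx y hy
    have h1 := hu _ ((mem_dilate hα).1 hx) _ ((mem_dilate hα).1 hy)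
    rw [inner_smul_right, inner_smul_right] at h1
    exact le_of_mul_le_mul_left h1 (inv_pos.2 hα)

theorem isExposed_dilate {α : ℝ} (hα : 0 < α) {P F : Polytope d}
    (h : IsExposed ℝ P.carrier F.carrier) :
    IsExposed ℝ (P.dilate α).carrier (F.dilate α).carrier := by
  intro _
  obtain ⟨l, hl⟩ := h F.nonempty
  refine ⟨l, ?_⟩
  ext x
  rw [mem_dilate hα, hl]
  simp only [Set.mem_ofPred_eq, mem_dilate hα]
  refine and_congr_right fun _ => ⟨fun h y hy => ?_, fun h y hy => ?_⟩
  · have h1 := h _ hy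
    rw [map_smul, map_smul, smul_eq_mul, smul_eq_mul] at h1
    exact le_of_mul_le_mul_left h1 (inv_pos.2 hα)
  · have h1 := h (α • y) (by rwa [inv_smul_smul₀ hα.ne'])
    rw [map_smul, smul_eq_mul] at h1 ⊢
    rwa [inv_mul_eq_div, le_div_iff₀' hα]

theorem dilate_mem_faces {α : ℝ} (hα : 0 < α) {j : ℕ} {P F : Polytope d} (h : F ∈ faces j P) :
    F.dilate α ∈ faces j (P.dilate α) := by
  refine ⟨isExposed_dilate hα h.1, ?_⟩
  have h1 := dim_add_finrank_span_normalCone (isExposed_dilate hα h.1)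
  have h2 := dim_add_finrank_span_normalCone h.1
  rw [normalCone_dilate hα] at h1
  have := h.2
  omega

/-- The faces of a dilate are the dilates of the faces. -/
noncomputable def dilateFaces {α : ℝ} (hα : 0 < α) (j : ℕ) (P : Polytope d) :
    faces j P ≃ faces j (P.dilate α) where
  toFun F := ⟨F.1.dilate α, dilate_mem_faces hα F.2⟩
  invFun F := ⟨F.1.dilate α⁻¹, by
    have h := dilate_mem_faces (inv_pos.2 hα) F.2
    rwa [dilate_dilate, inv_mul_cancel₀ hα.ne', dilate_one] at h⟩
  left_inv F := Subtype.ext (by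
    change (F.1.dilate α).dilate α⁻¹ = F.1
    rw [dilate_dilate, inv_mul_cancel₀ hα.ne', dilate_one])
  right_inv F := Subtype.ext (by
    change (F.1.dilate α⁻¹).dilate α = F.1
    rw [dilate_dilate, mul_inv_cancel₀ hα.ne', dilate_one])

theorem faceMeasure_dilate {α : ℝ} (hα : 0 < α) (j : ℕ) (F : Polytope d) {A : Set (E d)}
    (hA : MeasurableSet A) : (faceMeasure j (F.dilate α)).real (α • A) =
      α ^ j * (faceMeasure j F).real A := by
  rw [faceMeasure, faceMeasure, measureReal_restrict_apply hA,
    measureReal_restrict_apply (hA.const_smul₀ α), carrier_dilate,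
    ← Set.smul_set_inter₀ hα.ne', measureReal_def,
    Measure.euclideanHausdorffMeasure_smul₀ j hα.ne', measureReal_def, ENNReal.smul_def,
    smul_eq_mul, ENNReal.toReal_mul]
  simp [abs_of_pos hα]

theorem normalCone_self (F : Polytope d) :
    F.normalCone F = ((vectorSpan ℝ F.carrier)ᗮ : Submodule ℝ (E d)) := by
  refine Set.Subset.antisymm ?_ fun u hu x hx y hy => ?_
  · rw [← span_normalCone (IsExposed.refl F.carrier)]
    exact Submodule.subset_span
  · have h1 := (Submodule.mem_orthogonal' _ _).1 hu _ (vsub_mem_vectorSpan ℝ hy hx)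
    rw [vsub_eq_sub, inner_sub_right] at h1
    linarith

/-- The intrinsic volume of a polytope in its own dimension is its Lebesgue measure. -/
theorem intrinsicVolume_dim {j : ℕ} {F : Polytope d} (hF : F.dim = j) :
    F.intrinsicVolume j = (faceMeasure j F).real Set.univ := by
  subst hF
  have hmem : F ∈ faces F.dim F := mem_faces_dim_iff.2 rfl
  rw [intrinsicVolume, Finset.sum_eq_single ⟨F, hmem⟩]
  · have h1 : F.externalAngle F.dim F = 1 := by
      rw [externalAngle, normalCone_self, Submodule.span_eq]
      refine div_self (ne_of_gt ?_)
      set W := (vectorSpan ℝ F.carrier)ᗮ with hW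
      have hrank : finrank ℝ W = d - F.dim := by
        have := dim_add_finrank_span_normalCone (IsExposed.refl (𝕜 := ℝ) F.carrier)
        rw [span_normalCone (IsExposed.refl _)] at this
        exact Nat.eq_sub_of_add_eq' this
      rw [measureReal_def, euclideanHausdorffMeasure_eq_volume_preimage hrank (x := 0)
        (fun y hy => by simpa using hy.1)]
      have h2 : (fun v : W => (0 : E d) + v) ⁻¹' ((W : Set (E d)) ∩ Metric.closedBall 0 1) =
          Metric.closedBall 0 1 := by
        ext v
        simp
      rw [h2]
      exact ENNReal.toReal_pos (Metric.measure_closedBall_pos _ _ one_pos).ne'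
        measure_closedBall_lt_top.ne
    rw [h1, one_mul]
  · intro G _ hG
    have h1 : G.1 = F := mem_faces_dim_iff.1 G.2
    exact (hG (Subtype.ext h1)).elim
  · exact fun h => absurd (Finset.mem_univ _) h

/-- The cube `[-1, 1]^d` as a polytope. -/
def cube (d : ℕ) : Polytope d :=
  ⟨⟨⟨unitCube d, isCompact_unitCube d⟩, ⟨0, fun i => by simp⟩⟩, by
    obtain ⟨t, ht⟩ := exists_eq_convexHull_inter_unitCube (d := d) ∅
    refine ⟨t, ?_⟩
    rw [← ht]
    simp only [Finset.notMem_empty, IsEmpty.forall_iff, implies_true, Set.ofPred_true,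
      Set.univ_inter]
    rfl⟩

theorem volume_real_cube_pos (d : ℕ) : 0 < volume.real (cube d).carrier := by
  refine ENNReal.toReal_pos (ne_of_gt ?_) (cube d).isCompact.measure_ne_top
  exact (Metric.measure_closedBall_pos volume (0 : E d) one_pos).trans_le
    (measure_mono (closedBall_subset_unitCube d le_rfl))

theorem volume_eq_zero_of_dim_ne {P : Polytope d} (h : P.dim ≠ d) : volume P.carrier = 0 := by
  refine measure_mono_null (subset_affineSpan ℝ _) (Measure.addHaar_affineSubspace _ _ fun htop => h ?_)
  have h1 : vectorSpan ℝ P.carrier = ⊤ := by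
    rw [← direction_affineSpan, htop, AffineSubspace.direction_top]
  rw [dim, h1, finrank_top, finrank_euclideanSpace_fin]

theorem dim_cube (d : ℕ) : (cube d).dim = d := by
  by_contra h
  have h1 := volume_real_cube_pos d
  rw [measureReal_def, volume_eq_zero_of_dim_ne h] at h1
  simp at h1

theorem normalCone_self_of_dim_eq {P : Polytope d} (h : P.dim = d) : P.normalCone P = {0} := by
  have h1 : vectorSpan ℝ P.carrier = ⊤ :=
    Submodule.eq_top_of_finrank_eq (h.trans finrank_euclideanSpace_fin.symm)
  rw [normalCone_self, h1, Submodule.top_orthogonal_eq_bot, Submodule.bot_coe]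

end Polytope

/-! ### The homogeneous parts of a local extension. -/

namespace IsLocalExtension

variable {d : ℕ} {φ : Polytope d → ℝ} {Φ : Polytope d → SignedMeasure (E d)}

/-- Dilation preserves normal cones, hence densities, so only the scaling of `j`-dimensional measure
remains. -/
theorem faceSum_dilate (hΦ : IsLocalExtension φ Φ) {α : ℝ} (hα : 0 < α) (j : ℕ) (P : Polytope d)
    {A : Set (E d)} (hA : MeasurableSet A) :
    faceSum Φ j (P.dilate α) (α • A) = α ^ j * faceSum Φ j P A := by
  rw [faceSum, faceSum, Finset.mul_sum]
  refine (Fintype.sum_equiv (Polytope.dilateFaces hα j P) _ _ fun F => ?_).symm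
  change _ = faceDensity Φ (P.dilate α) (F.1.dilate α) *
    (Polytope.faceMeasure j (F.1.dilate α)).real (α • A)
  rw [Polytope.faceMeasure_dilate hα j F.1 hA, hΦ.faceDensity_eq
    (Polytope.isExposed_dilate hα F.2.1) F.2.1 (Polytope.normalCone_dilate hα P F.1)]
  ring

/-- The contribution of the `j`-faces is a linear combination of values of the local extension at
dilates. -/
theorem exists_faceSum_eq (hΦ : IsLocalExtension φ Φ) (j : Fin (d + 1)) :
    ∃ c : Fin (d + 1) → ℝ, ∀ (P : Polytope d) (A : Set (E d)), MeasurableSet A →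
      faceSum Φ j P A =
        ∑ k : Fin (d + 1), c k * Φ (P.dilate ((k : ℝ) + 1)) (((k : ℝ) + 1) • A) := by
  obtain ⟨c, hc⟩ := exists_coeff_eq_sum_eval (d + 1)
  refine ⟨c j, fun P A hA => (hc (fun i => faceSum Φ i P A) j).trans ?_⟩
  refine Finset.sum_congr rfl fun k _ => ?_
  rw [hΦ.apply_eq_sum_faceSum _ (hA.const_smul₀ _)]
  congr 1
  exact Finset.sum_congr rfl fun i _ => (hΦ.faceSum_dilate (by positivity) i P hA).symm

/-- The contribution of the faces of full dimension is a multiple of the Lebesgue measure. -/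
theorem faceSum_dim (hΦ : IsLocalExtension φ Φ) (P : Polytope d) {A : Set (E d)}
    (hA : MeasurableSet A) : faceSum Φ d P A =
      faceDensity Φ (Polytope.cube d) (Polytope.cube d) * volume.real (P.carrier ∩ A) := by
  by_cases hP : P.dim = d
  · have hmem : P ∈ Polytope.faces d P := ⟨IsExposed.refl _, hP⟩
    rw [faceSum, Finset.sum_eq_single ⟨P, hmem⟩]
    -- All full-dimensional polytopes share the normal cone `{0}`; the cube serves as reference for
    -- the common density.
    · rw [hΦ.faceDensity_eq (IsExposed.refl _) (IsExposed.refl (Polytope.cube d).carrier)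
        ((Polytope.normalCone_self_of_dim_eq hP).trans
          (Polytope.normalCone_self_of_dim_eq (Polytope.dim_cube d)).symm),
        Polytope.faceMeasure, measureReal_restrict_apply hA,
        EuclideanSpace.euclideanHausdorffMeasure_eq_volume, Set.inter_comm]
    · intro G _ hG
      have h1 : G.1 = P := Polytope.eq_of_subset_of_dim_le G.2.1 (IsExposed.refl _) G.2.1.subset
        (hP.trans G.2.2.symm).le
      exact (hG (Subtype.ext h1)).elim
    · exact fun h => absurd (Finset.mem_univ _) h
  · have hempty : IsEmpty (Polytope.faces d P) := ⟨fun F => hP (le_antisymm P.dim_le (by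
      have h1 : F.1.dim ≤ P.dim := Submodule.finrank_mono (vectorSpan_mono ℝ F.2.1.subset)
      exact F.2.2.symm.le.trans h1))⟩
    rw [faceSum, Finset.univ_eq_empty, Finset.sum_empty, measureReal_def,
      measure_mono_null Set.inter_subset_left (Polytope.volume_eq_zero_of_dim_ne hP),
      ENNReal.toReal_zero, mul_zero]

end IsLocalExtension

/-- The contribution of the `j`-faces to a local extension as a signed measure. -/
noncomputable def faceSignedMeasure {d : ℕ} (Φ : Polytope d → SignedMeasure (E d)) (j : ℕ)
    (P : Polytope d) : SignedMeasure (E d) :=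
  ∑ F : Polytope.faces j P,
    haveI := Polytope.isFiniteMeasure_faceMeasure F.2.2
    faceDensity Φ P F.1 • (Polytope.faceMeasure j F.1).toSignedMeasure

theorem faceSignedMeasure_apply {d : ℕ} (Φ : Polytope d → SignedMeasure (E d)) (j : ℕ)
    (P : Polytope d) {A : Set (E d)} (hA : MeasurableSet A) :
    faceSignedMeasure Φ j P A = faceSum Φ j P A := by
  rw [faceSignedMeasure, faceSum, sum_apply]
  refine Finset.sum_congr rfl fun F _ => ?_
  have := Polytope.isFiniteMeasure_faceMeasure F.2.2
  rw [smul_apply, Measure.toSignedMeasure_apply_measurable hA, smul_eq_mul]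

namespace IsLocalExtension

variable {d : ℕ} {φ : Polytope d → ℝ} {Φ : Polytope d → SignedMeasure (E d)}

/-- Measurability and locality are not visible from the sum over faces. They are inherited from `Φ`
through the combination of values at dilates, whose coefficients depend neither on `P` nor on `A`.
-/
theorem faceSignedMeasure (hΦ : IsLocalExtension φ Φ) (j : Fin (d + 1)) :
    IsLocalExtension (fun P => faceSum Φ j P Set.univ) (faceSignedMeasure Φ j) := by
  obtain ⟨c, hc⟩ := hΦ.exists_faceSum_eq j
  refine ⟨fun A hA => ?_, fun P => (faceSignedMeasure_apply Φ j P MeasurableSet.univ).symm,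
    fun P A x hA => ?_, fun P Q A U hA hU hPQ hAU => ?_⟩
  · simp_rw [fun P => faceSignedMeasure_apply Φ j P hA, fun P => hc P A hA]
    exact Finset.measurable_sum _ fun k _ => ((hΦ.measurable _ (hA.const_smul₀ _)).comp
      (Polytope.continuous_dilate _).measurable).const_mul _
  · have hAx : MeasurableSet ((fun y => y + x) '' A) :=
      (MeasurableEquiv.addRight x).measurableSet_image.2 hA
    rw [faceSignedMeasure_apply Φ j _ hAx, faceSignedMeasure_apply Φ j P hA, hc _ _ hAx, hc P A hA]
    refine Finset.sum_congr rfl fun k _ => ?_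
    rw [Polytope.translate_dilate, ← hΦ.translation_covariant _ _ (((k : ℝ) + 1) • x)
      (hA.const_smul₀ _), ← Set.image_smul, ← Set.image_smul, Set.image_image, Set.image_image]
    simp only [smul_add]
  · rw [faceSignedMeasure_apply Φ j P hA, faceSignedMeasure_apply Φ j Q hA, hc P A hA, hc Q A hA]
    refine Finset.sum_congr rfl fun k _ => ?_
    have hk : (k : ℝ) + 1 ≠ 0 := by positivity
    rw [hΦ.locally_determined (P.dilate ((k : ℝ) + 1)) (Q.dilate ((k : ℝ) + 1)) _
      (((k : ℝ) + 1) • U) (hA.const_smul₀ _) (hU.smul₀ hk) ?_ (Set.smul_set_mono hAU)]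
    rw [Polytope.carrier_dilate, Polytope.carrier_dilate, ← Set.smul_set_inter₀ hk, hPQ,
      Set.smul_set_inter₀ hk]

theorem isHomogeneous_faceSum (hΦ : IsLocalExtension φ Φ) (j : ℕ) :
    IsHomogeneous j fun P => faceSum Φ j P Set.univ := fun α P hα => by
  have h1 := hΦ.faceSum_dilate hα j P MeasurableSet.univ
  rwa [Set.smul_set_univ₀ hα.ne'] at h1

theorem isMeasureHomogeneous_faceSignedMeasure (hΦ : IsLocalExtension φ Φ) (j : ℕ) :
    IsMeasureHomogeneous j (_root_.faceSignedMeasure Φ j) := fun α P A hα hA => by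
  rw [faceSignedMeasure_apply Φ j _ (hA.const_smul₀ α), faceSignedMeasure_apply Φ j P hA,
    hΦ.faceSum_dilate hα j P hA]

theorem apply_eq_sum_add (hΦ : IsLocalExtension φ Φ) (P : Polytope d) {A : Set (E d)}
    (hA : MeasurableSet A) : Φ P A = ∑ j : Fin d, faceSum Φ j P A +
      faceDensity Φ (Polytope.cube d) (Polytope.cube d) * volume.real (P.carrier ∩ A) := by
  rw [hΦ.apply_eq_sum_faceSum P hA, Fin.sum_univ_castSucc, Fin.val_last, hΦ.faceSum_dim P hA]
  rfl

theorem faceDensity_polarFace (hΦ : IsLocalExtension φ Φ) {j : Fin d} (P : Polytope d)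
    (F : Polytope.faces (j : ℕ) P) :
    faceDensity Φ (SphericalPolytope.polarPolytope (P.normalImage F))
      (SphericalPolytope.polarFace (P.normalImage F)) = faceDensity Φ P F.1 :=
  hΦ.faceDensity_eq (SphericalPolytope.isExposed_polarFace _) F.2.1
    (SphericalPolytope.normalCone_polarFace (Polytope.isPolyhedralCone_normalCone P F.1) rfl)

theorem isFaceSum_faceSignedMeasure (hΦ : IsLocalExtension φ Φ) (j : Fin d) :
    IsFaceSum j (_root_.faceSignedMeasure Φ j) fun p =>
      faceDensity Φ (SphericalPolytope.polarPolytope p) (SphericalPolytope.polarFace p) :=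
  fun P A hA => by
    rw [faceSignedMeasure_apply Φ j P hA, faceSum]
    exact Finset.sum_congr rfl fun F _ => by rw [← hΦ.faceDensity_polarFace P F]

end IsLocalExtension

/-! ### Uniqueness and the main theorem. -/

/-- An explicit formula for `f` in terms of `Ψ`, from which both its uniqueness and its
measurability follow. -/
theorem IsFaceSum.eq_div {d : ℕ} {j : Fin d} {Ψ : Polytope d → SignedMeasure (E d)}
    {f : SphericalPolytope d (d - 1 - j) → ℝ} (h : IsFaceSum j Ψ f)
    (p : SphericalPolytope d (d - 1 - j)) :
    f p = Ψ (SphericalPolytope.polarPolytope p) (Metric.closedBall 0 (1 / 2)) /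
      volume.real (Metric.closedBall (0 : E j) (1 / 2)) := by
  rw [h _ _ Metric.isClosed_closedBall.measurableSet, SphericalPolytope.sum_faces_polarPolytope,
    mul_div_cancel_right₀ _ (SphericalPolytope.volume_real_closedBall_pos j).ne']

/-- At the dilates of `P` both decompositions are polynomials in the factor, so their coefficients
agree. The constants are then separated by a polytope of positive volume, the cube. -/
theorem IsDecomposition.eq {d : ℕ} {φ : Polytope d → ℝ} {ψ ψ' : Fin d → Polytope d → ℝ} {c c' : ℝ}
    (h : IsDecomposition φ ψ c) (h' : IsDecomposition φ ψ' c') : ψ' = ψ ∧ c' = c := by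
  have key : ∀ P, (fun j => ψ' j P) = (fun j => ψ j P) ∧
      c' * volume.real P.carrier = c * volume.real P.carrier := by
    intro P
    refine eq_and_eq_of_forall_pos_sum_pow_eq fun α hα => ?_
    have hvol : volume.real (P.dilate α).carrier = α ^ d * volume.real P.carrier := by
      rw [Polytope.carrier_dilate, measureReal_def, Measure.addHaar_smul_of_nonneg _ hα.le,
        ENNReal.toReal_mul, ENNReal.toReal_ofReal (by positivity), finrank_euclideanSpace_fin,
        measureReal_def]
    have h1 := (h.2 (P.dilate α)).symm.trans (h'.2 (P.dilate α))
    simp_rw [fun j => (h.1 j).2 α P hα, fun j => (h'.1 j).2 α P hα, hvol] at h1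
    linarith
  refine ⟨funext fun j => funext fun P => congrFun (key P).1 j, ?_⟩
  exact mul_right_cancel₀ (Polytope.volume_real_cube_pos d).ne' (key (Polytope.cube d)).2

theorem IsMeasureDecomposition.eq {d : ℕ} {Φ : Polytope d → SignedMeasure (E d)}
    {Ψ Ψ' : Fin d → Polytope d → SignedMeasure (E d)} {c c' : ℝ}
    (h : IsMeasureDecomposition Φ Ψ c) (h' : IsMeasureDecomposition Φ Ψ' c') :
    Ψ' = Ψ ∧ c' = c := by
  have key : ∀ P A, MeasurableSet A → (fun j => Ψ' j P A) = (fun j => Ψ j P A) ∧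
      c' * volume.real (P.carrier ∩ A) = c * volume.real (P.carrier ∩ A) := by
    intro P A hA
    refine eq_and_eq_of_forall_pos_sum_pow_eq fun α hα => ?_
    have hvol : volume.real ((P.dilate α).carrier ∩ α • A) =
        α ^ d * volume.real (P.carrier ∩ A) := by
      rw [Polytope.carrier_dilate, ← Set.smul_set_inter₀ hα.ne', measureReal_def,
        Measure.addHaar_smul_of_nonneg _ hα.le, ENNReal.toReal_mul,
        ENNReal.toReal_ofReal (by positivity), finrank_euclideanSpace_fin, measureReal_def]
    have h1 := (h.2 (P.dilate α) _ (hA.const_smul₀ α)).symm.trans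
      (h'.2 (P.dilate α) _ (hA.const_smul₀ α))
    simp_rw [fun j => h.1 j α P A hα hA, fun j => h'.1 j α P A hα hA, hvol] at h1
    linarith
  refine ⟨funext fun j => funext fun P => VectorMeasure.ext fun A hA =>
    congrFun (key P A hA).1 j, ?_⟩
  have h1 := (key (Polytope.cube d) Set.univ MeasurableSet.univ).2
  rw [Set.inter_univ] at h1
  exact mul_right_cancel₀ (Polytope.volume_real_cube_pos d).ne' h1

theorem theorem2p1 (d : ℕ) (φ : Polytope d → ℝ) (Φ : Polytope d → MeasureTheory.SignedMeasure (E d))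
    (hΦ : IsLocalExtension φ Φ) :
    ∃ (ψ : Fin d → Polytope d → ℝ) (Ψ : Fin d → Polytope d → MeasureTheory.SignedMeasure (E d))
      (c : ℝ) (f : (j : Fin d) → SphericalPolytope d (d - 1 - j) → ℝ),
      -- the unique decomposition of the functional
      (IsDecomposition φ ψ c ∧ ∀ ψ' c', IsDecomposition φ ψ' c' → ψ' = ψ ∧ c' = c) ∧
      -- the unique decomposition of the local extension, with the same constant
      (IsMeasureDecomposition Φ Ψ c ∧
        ∀ Ψ' c', IsMeasureDecomposition Φ Ψ' c' → Ψ' = Ψ ∧ c' = c) ∧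
      -- the form of the homogeneous parts of the local extension
      (∀ j : Fin d, Measurable (f j) ∧ IsFaceSum j (Ψ j) (f j) ∧
        ∀ g, IsFaceSum j (Ψ j) g → g = f j) ∧
      -- the homogeneous parts of the local extension extend those of the functional
      (∀ j : Fin d, IsLocalExtension (ψ j) (Ψ j)) ∧
      (∀ (j : Fin d) (P : Polytope d), ψ j P =
        ∑ F : Polytope.faces (j : ℕ) P, f j (P.normalImage F) * F.1.intrinsicVolume j) ∧
      -- nonnegativity
      ((∀ P, 0 ≤ Φ P) →
        (∀ j p, 0 ≤ f j p) ∧ 0 ≤ c ∧ (∀ j P, 0 ≤ Ψ j P) ∧ (∀ j P, 0 ≤ ψ j P) ∧ ∀ P, 0 ≤ φ P) := by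
  have hnn : (∀ P, 0 ≤ Φ P) → ∀ P F, 0 ≤ faceDensity Φ P F := fun h P F => by
    by_cases hF : MeasurableSet (P.openFace F)
    · exact div_nonneg (h P _ hF) measureReal_nonneg
    -- Signed measures take the value `0` on non-measurable sets, so `F` need not be a face of `P`
    -- here.
    · rw [faceDensity, (Φ P).not_measurable hF, zero_div]
  have hsum : (∀ P, 0 ≤ Φ P) → ∀ j P A, 0 ≤ faceSum Φ j P A := fun h j P A =>
    Finset.sum_nonneg fun F _ => mul_nonneg (hnn h P F.1) measureReal_nonneg
  have hdec : IsDecomposition φ (fun (j : Fin d) P => faceSum Φ j P Set.univ)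
      (faceDensity Φ (Polytope.cube d) (Polytope.cube d)) :=
    ⟨fun j => ⟨⟨_, hΦ.faceSignedMeasure j.castSucc⟩, hΦ.isHomogeneous_faceSum j⟩, fun P => by
      rw [hΦ.total, hΦ.apply_eq_sum_add P MeasurableSet.univ, Set.inter_univ]⟩
  have hmdec : IsMeasureDecomposition Φ (fun j : Fin d => faceSignedMeasure Φ j)
      (faceDensity Φ (Polytope.cube d) (Polytope.cube d)) :=
    ⟨fun j => hΦ.isMeasureHomogeneous_faceSignedMeasure j, fun P A hA => by
      simp_rw [fun j : ℕ => faceSignedMeasure_apply Φ j P hA]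
      exact hΦ.apply_eq_sum_add P hA⟩
  refine ⟨_, _, _, fun j p => faceDensity Φ (SphericalPolytope.polarPolytope p)
    (SphericalPolytope.polarFace p), ⟨hdec, fun _ _ h => hdec.eq h⟩,
    ⟨hmdec, fun _ _ h => hmdec.eq h⟩,
    fun j => ⟨?_, hΦ.isFaceSum_faceSignedMeasure j, fun g hg => funext fun p => ?_⟩,
    fun j => hΦ.faceSignedMeasure j.castSucc, fun j P => ?_, fun h => ⟨fun j p => hnn h _ _,
      hnn h _ _, fun j P A hA => ?_, fun j P => hsum h j P _, fun P => ?_⟩⟩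
  · change Measurable fun p => faceDensity Φ (SphericalPolytope.polarPolytope p)
      (SphericalPolytope.polarFace p)
    rw [funext (hΦ.isFaceSum_faceSignedMeasure j).eq_div]
    exact (((hΦ.faceSignedMeasure j.castSucc).measurable _
      Metric.isClosed_closedBall.measurableSet).comp
        SphericalPolytope.continuous_polarPolytope.measurable).div_const _
  · exact (hg.eq_div p).trans ((hΦ.isFaceSum_faceSignedMeasure j).eq_div p).symm
  · refine Finset.sum_congr rfl fun F _ => ?_
    rw [← hΦ.faceDensity_polarFace P F, Polytope.intrinsicVolume_dim F.2.2]
  · rw [faceSignedMeasure_apply Φ j P hA]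
    exact hsum h j P A
  · rw [hΦ.total]
    exact h P _ MeasurableSet.univ
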